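/- Let $d\ge 1$, let $\mathcal{M}_d$ be the algebra of complex $d\times d$ matrices with identity $\mathbb{1}$, and let $\mathcal{E}:\mathcal{M}_d\to\mathcal{M}_d$ be a positive linear map, i.e. $\mathcal{E}(A)\ge 0$ whenever $A\ge 0$ (positive semidefinite). Write $\mathcal{E}^*$ for the adjoint of $\mathcal{E}$ with respect to the inner product $\operatorname{tr}(A^\dagger B)$. Definitions. A linear map $\mathcal{F}$ on $\mathcal{M}_d$ is *doubly stochastic* if $\mathcal{F}(\mathbb{1})=\mathcal{F}^*(\mathbb{1})=\mathbb{1}$. Matrices $X,Y\in\mathcal{M}_d$ are *scaling matrices* for $\mathcal{E}$ if $A\mapsto Y^\dagger\mathcal{E}(XAX^\dagger)Y$ is doubly stochastic; $\mathcal{E}$ is *scalable* to a doubly stochastic map if scaling matrices exist. The map $\mathcal{F}$ is *fully indecomposable* if $\mathcal{F}\ne 0$ and any two nonzero orthogonal projections $P,Q$ of equal rank with $\mathcal{F}(P\mathcal{M}_dP)\subseteq Q\mathcal{M}_dQ$ satisfy $P=Q=\mathbb{1}$; the same definition is used for linear maps $R\mathcal{M}_dR\to R\mathcal{M}_dR$,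 where $R$ is an orthogonal projection, with $R$ as the identity and $P,Q\in R\mathcal{M}_dR$. The map $\mathcal{F}$ is a *direct sum of fully indecomposable maps* if there are orthogonal projections $P_1,\dots,P_k$ with $P_iP_j=0$ for $i\ne j$ and $\sum_iP_i=\mathbb{1}$ such that, for every $i$, $\mathcal{F}(P_i\mathcal{M}_dP_i)\subseteq P_i\mathcal{M}_dP_i$ and the restriction of $\mathcal{F}$ to $P_i\mathcal{M}_dP_i$ is fully indecomposable. The scaling matrices of $\mathcal{E}$ are *unique* if they exist and, for any two pairs $(X_1,Y_1)$, $(X_2,Y_2)$ of scaling matrices, there are a real $c>0$ and unitaries $U,V\in\mathcal{M}_d$ with $X_2=c\,X_1U$ and $Y_2=c^{-1}\,Y_1V$. Theorem. 1. $\mathcal{E}$ is scalable to a doubly stochastic map if and only if there exist matrices $X,Y\in\mathcal{M}_d$ such that the map $A\mapsto Y\mathcal{E}(XAX^\dagger)Y^\dagger$ is a direct sum of fully indecomposable maps. 2. The scaling matrices of $\mathcal{E}$ are unique if and only if $\mathcal{E}$ is fully indecomposable. -/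

import Mathlib

open scoped Matrix ComplexOrder

/-- The algebra of complex `d × d` matrices. -/
abbrev MatC (d : ℕ) : Type := Matrix (Fin d) (Fin d) ℂ

/-- A linear map on complex matrices is positive if it sends positive semidefinite matrices to
positive semidefinite matrices. -/
def IsPositiveMap {d : ℕ} (E : MatC d →ₗ[ℂ] MatC d) : Prop :=
  ∀ A : MatC d, A.PosSemidef → (E A).PosSemidef

/-- The adjoint `E^*` of a linear map for the Hilbert-Schmidt inner product `tr (A† B)`; it is
characterized by `trace_hsAdjoint_conjTranspose_mul` below. -/
def hsAdjoint {d : ℕ} (E : MatC d →ₗ[ℂ] MatC d) : MatC d →ₗ[ℂ] MatC d where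
  toFun B := Matrix.of fun i j => ((E (Matrix.single i j 1))ᴴ * B).trace
  map_add' B C := by
    ext i j
    simp [mul_add]
  map_smul' c B := by
    ext i j
    simp

theorem trace_hsAdjoint_conjTranspose_mul {d : ℕ} (E : MatC d →ₗ[ℂ] MatC d) (B A : MatC d) :
    ((hsAdjoint E B)ᴴ * A).trace = (Bᴴ * E A).trace := by
  have hA : E A = ∑ i, ∑ j, A i j • E (Matrix.single i j 1) := by
    conv_lhs => rw [Matrix.matrix_eq_sum_single A]
    simp only [map_sum]
    refine Finset.sum_congr rfl fun i _ => Finset.sum_congr rfl fun j _ => ?_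
    rw [← map_smul, Matrix.smul_single, smul_eq_mul, mul_one]
  have hc : ∀ i j, star ((hsAdjoint E B) i j) = (Bᴴ * E (Matrix.single i j 1)).trace := by
    intro i j
    simp only [hsAdjoint, LinearMap.coe_mk, AddHom.coe_mk, Matrix.of_apply]
    rw [← Matrix.trace_conjTranspose, Matrix.conjTranspose_mul, Matrix.conjTranspose_conjTranspose]
  rw [hA]
  simp only [Finset.mul_sum, Matrix.trace_sum, Matrix.mul_smul, Matrix.trace_smul, ← hc]
  rw [Matrix.trace, Finset.sum_comm]
  simp only [Matrix.diag_apply, Matrix.mul_apply, Matrix.conjTranspose_apply, smul_eq_mul]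
  exact Finset.sum_congr rfl fun i _ => Finset.sum_congr rfl fun j _ => mul_comm _ _

/-- A map is doubly stochastic if `E(1) = 1` and `E^*(1) = 1`. -/
def IsDoublyStochasticMap {d : ℕ} (E : MatC d →ₗ[ℂ] MatC d) : Prop :=
  E 1 = 1 ∧ hsAdjoint E 1 = 1

/-- The map `A ↦ Y† E(X A X†) Y`. -/
def scaledMap {d : ℕ} (E : MatC d →ₗ[ℂ] MatC d) (X Y : MatC d) : MatC d →ₗ[ℂ] MatC d where
  toFun A := Yᴴ * E (X * A * Xᴴ) * Y
  map_add' A B := by simp [mul_add, add_mul]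
  map_smul' c A := by simp

/-- The matrices `X`, `Y` scale `E` to a doubly stochastic map. -/
def IsScaling {d : ℕ} (E : MatC d →ₗ[ℂ] MatC d) (X Y : MatC d) : Prop :=
  IsDoublyStochasticMap (scaledMap E X Y)

/-- `E` is scalable to a doubly stochastic map. -/
def IsScalable {d : ℕ} (E : MatC d →ₗ[ℂ] MatC d) : Prop :=
  ∃ X Y : MatC d, IsScaling E X Y

/-- The corner `P M_d P`. -/
def corner {d : ℕ} (P : MatC d) : Set (MatC d) := Set.range fun A : MatC d => P * A * P

/-- `E` is fully indecomposable: it is nonzero, and any two nonzero orthogonal projections `P`, `Q`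
of the same rank with `E(P M_d P) ⊆ Q M_d Q` are both the identity. (For `d ≥ 2` the first condition
follows from the second; for `d = 1` it excludes the zero map.) -/
def IsFullyIndecomposable {d : ℕ} (E : MatC d →ₗ[ℂ] MatC d) : Prop :=
  E ≠ 0 ∧ ∀ P Q : MatC d, IsStarProjection P → IsStarProjection Q → P ≠ 0 → Q ≠ 0 →
    P.rank = Q.rank → Set.MapsTo E (corner P) (corner Q) → P = 1 ∧ Q = 1

/-- For an orthogonal projection `R`: `E` maps `R M_d R` to itself, and the restriction
`R M_d R → R M_d R` is fully indecomposable. Here `R M_d R` is the matrix algebra of the range of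
`R`, with identity `R`, and its orthogonal projections are those of `M_d` that lie in it. -/
def IsFullyIndecomposableOn {d : ℕ} (E : MatC d →ₗ[ℂ] MatC d) (R : MatC d) : Prop :=
  Set.MapsTo E (corner R) (corner R) ∧ (∃ A ∈ corner R, E A ≠ 0) ∧
    ∀ P Q : MatC d, IsStarProjection P → IsStarProjection Q → P ∈ corner R → Q ∈ corner R →
      P ≠ 0 → Q ≠ 0 → P.rank = Q.rank → Set.MapsTo E (corner P) (corner Q) → P = R ∧ Q = R

/-- On the whole matrix algebra the relative notion is the absolute one. -/
theorem isFullyIndecomposableOn_one {d : ℕ} (E : MatC d →ₗ[ℂ] MatC d) :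
    IsFullyIndecomposableOn E 1 ↔ IsFullyIndecomposable E := by
  have h1 : corner (1 : MatC d) = Set.univ := by
    ext A
    simp [corner]
  have h2 : (∃ A, E A ≠ 0) ↔ E ≠ 0 := by
    rw [← not_forall_not, not_iff_not]
    simp [LinearMap.ext_iff]
  simp [IsFullyIndecomposableOn, IsFullyIndecomposable, h1, ← h2]

/-- `E` is a direct sum of fully indecomposable maps: there are pairwise orthogonal projections
`P₁, …, P_k` with sum `1` such that `E` maps each `P_i M_d P_i` to itself, the restriction being
fully indecomposable. -/
def IsDirectSumOfFullyIndecomposables {d : ℕ} (E : MatC d →ₗ[ℂ] MatC d) : Prop :=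
  ∃ (k : ℕ) (P : Fin k → MatC d), (∀ i, IsStarProjection (P i)) ∧
    (∀ i j, i ≠ j → P i * P j = 0) ∧ ∑ i, P i = 1 ∧ ∀ i, IsFullyIndecomposableOn E (P i)

/-- `E` is uniquely scalable: scaling matrices exist, and any two pairs `(X₁, Y₁)`, `(X₂, Y₂)` of
scaling matrices agree up to a reciprocal positive scalar and unitaries acting from the right.
(These changes are always possible: they turn a doubly stochastic `E'` into `V† E'(U · U†) V`.) -/
def IsUniquelyScalable {d : ℕ} (E : MatC d →ₗ[ℂ] MatC d) : Prop :=
  IsScalable E ∧ ∀ X₁ Y₁ X₂ Y₂ : MatC d, IsScaling E X₁ Y₁ → IsScaling E X₂ Y₂ →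
    ∃ c : ℝ, 0 < c ∧ ∃ U ∈ Matrix.unitaryGroup (Fin d) ℂ, ∃ V ∈ Matrix.unitaryGroup (Fin d) ℂ,
      X₂ = (c : ℂ) • (X₁ * U) ∧ Y₂ = (c : ℂ)⁻¹ • (Y₁ * V)

/-! Existence of scalings is variational. For a fully indecomposable `E`, minimise tr(B E(A)) over
positive semidefinite A, B of determinant one. In eigenbases (u_j) of A and (w_i) of B this trace
sees `E` only through the nonnegative weights w_i† E(u_j u_j†) w_i. Full indecomposability says
that, in any two orthonormal bases, every nonempty proper index set J sends positive weight to its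
complement; compactness of the unitary group makes the bound uniform (`exists_uniform_bound`).
Ordering the eigenvalues oppositely then bounds sublevel sets (`exists_entry_bound`), so a minimiser
A = XX†, B = YY† exists. For the map F scaled by X and Y, minimality in B and in A is equality in
the arithmetic-geometric mean inequality for F(1) and F*(1), which are therefore scalar
(`eq_smul_one_of_trace_le`); a normalisation makes F doubly stochastic.

Uniqueness reduces to scalings (Z, W) of a map that is already doubly stochastic. Diagonalising ZZ†
and WW† turns the scaling equations into those of a doubly stochastic array of weights, and a
maximum principle makes all eigenvalues equal (`exists_const_of_scaled_weights`). Conversely, a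
doubly stochastic map sending the corner of P into that of Q, of equal rank, has E(P) = Q;
stretching along P and shrinking along Q gives another scaling, essentially different unless P = 1.

For direct sums, scale each block and add the scaling matrices; positivity takes care of the
off-diagonal blocks. Conversely, a doubly stochastic map splits 1 into minimal projections with
projections as images. The images are again orthogonal with the same ranks, and a unitary moves them
back to the originals (`exists_unitary_directSum`). -/

namespace Matrix.PosSemidef

/-! ### Positive semidefinite matrices -/

variable {n : Type*} [Fintype n] [DecidableEq n] {M N L : Matrix n n ℂ}

theorem exists_eq_conjTranspose_mul (hM : M.PosSemidef) : ∃ C : Matrix n n ℂ, M = Cᴴ * C := by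
  open scoped MatrixOrder Matrix.Norms.L2Operator in
  exact CStarAlgebra.nonneg_iff_eq_star_mul_self.mp (Matrix.nonneg_iff_posSemidef.mpr hM)

theorem trace_mul_nonneg (hM : M.PosSemidef) (hN : N.PosSemidef) : 0 ≤ (M * N).trace := by
  obtain ⟨C, rfl⟩ := hN.exists_eq_conjTranspose_mul
  rw [← Matrix.mul_assoc, Matrix.trace_mul_comm, ← Matrix.mul_assoc]
  exact (hM.mul_mul_conjTranspose_same C).trace_nonneg

theorem mul_eq_zero_of_trace (hM : M.PosSemidef) (hN : N.PosSemidef) (h : (M * N).trace = 0) :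
    M * N = 0 := by
  obtain ⟨C, rfl⟩ := hN.exists_eq_conjTranspose_mul
  rw [← Matrix.mul_assoc, Matrix.trace_mul_comm, ← Matrix.mul_assoc] at h
  have h0 := (hM.mul_mul_conjTranspose_same C).trace_eq_zero_iff.mp h
  obtain ⟨D, rfl⟩ := hM.exists_eq_conjTranspose_mul
  have h1 : (D * Cᴴ)ᴴ * (D * Cᴴ) = 0 := by
    rw [← h0, Matrix.conjTranspose_mul, Matrix.conjTranspose_conjTranspose]
    simp only [Matrix.mul_assoc]
  have h2 := Matrix.conjTranspose_mul_self_eq_zero.mp h1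
  rw [Matrix.mul_assoc, ← Matrix.mul_assoc D, h2]
  simp

/-- The trace of M N lies between 0 and that of L N, which vanishes. -/
theorem mul_eq_zero_of_le (hM : M.PosSemidef) (hML : (L - M).PosSemidef) (hN : N.PosSemidef)
    (h : L * N = 0) : M * N = 0 := by
  refine hM.mul_eq_zero_of_trace hN (le_antisymm ?_ (hM.trace_mul_nonneg hN))
  have := hML.trace_mul_nonneg hN
  rw [Matrix.sub_mul, h, Matrix.trace_sub, Matrix.trace_zero, zero_sub] at this
  exact neg_nonneg.mp this

theorem exists_le_smul_one (hM : M.PosSemidef) :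
    ∃ c : ℝ, 0 ≤ c ∧ ((c : ℂ) • (1 : Matrix n n ℂ) - M).PosSemidef := by
  open scoped MatrixOrder Matrix.Norms.L2Operator in
  refine ⟨‖M‖, norm_nonneg _, ?_⟩
  have h : M ≤ algebraMap ℝ _ ‖M‖ :=
    IsSelfAdjoint.le_algebraMap_norm_self (.of_nonneg (Matrix.nonneg_iff_posSemidef.mpr hM))
  rw [Matrix.le_iff, Algebra.algebraMap_eq_smul_one] at h
  rwa [Complex.coe_smul]

theorem span_eq_top :
    Submodule.span ℂ {A : Matrix n n ℂ | A.PosSemidef} = ⊤ := by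
  open scoped MatrixOrder Matrix.Norms.L2Operator in
  have h := CStarAlgebra.span_nonneg (A := Matrix n n ℂ)
  simpa only [Matrix.nonneg_iff_posSemidef] using h

end Matrix.PosSemidef

theorem Matrix.IsHermitian.exists_unitary_diagonal {n : Type*} [Fintype n] [DecidableEq n]
    {A : Matrix n n ℂ} (hA : A.IsHermitian) :
    ∃ U ∈ Matrix.unitaryGroup n ℂ, ∃ a : n → ℝ,
      A = U * Matrix.diagonal (fun i => (a i : ℂ)) * Uᴴ := by
  refine ⟨hA.eigenvectorUnitary, hA.eigenvectorUnitary.2, hA.eigenvalues, ?_⟩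
  conv_lhs => rw [hA.spectral_theorem, Unitary.conjStarAlgAut_apply]
  rfl

theorem Matrix.mem_unitaryGroup_left {n : Type*} [Fintype n] [DecidableEq n] {U : Matrix n n ℂ}
    (hU : U ∈ Matrix.unitaryGroup n ℂ) : Uᴴ * U = 1 := Matrix.mem_unitaryGroup_iff'.mp hU

theorem Matrix.mem_unitaryGroup_right {n : Type*} [Fintype n] [DecidableEq n] {U : Matrix n n ℂ}
    (hU : U ∈ Matrix.unitaryGroup n ℂ) : U * Uᴴ = 1 := Matrix.mem_unitaryGroup_iff.mp hU

/-! ### Orthogonal projections -/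

namespace IsStarProjection

variable {d : ℕ} {P Q : MatC d}

theorem mul_self (hP : IsStarProjection P) : P * P = P := hP.1

theorem conjTranspose_eq (hP : IsStarProjection P) : Pᴴ = P := hP.2

theorem posSemidef (hP : IsStarProjection P) : P.PosSemidef := by
  have := Matrix.posSemidef_conjTranspose_mul_self P
  rwa [hP.conjTranspose_eq, hP.mul_self] at this

theorem mul_eq_right_of_le (hP : IsStarProjection P) (hQ : IsStarProjection Q)
    (h : (P - Q).PosSemidef) : P * Q = Q := by
  have h1 := hQ.posSemidef.mul_eq_zero_of_le h hP.one_sub.posSemidef (by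
    rw [mul_sub, mul_one, hP.mul_self, sub_self])
  have h2 := congrArg Matrix.conjTranspose h1
  rw [Matrix.conjTranspose_mul, hQ.conjTranspose_eq, hP.one_sub.conjTranspose_eq,
    Matrix.conjTranspose_zero, sub_mul, one_mul, sub_eq_zero] at h2
  exact h2.symm

theorem mem_corner_iff {A : MatC d} (hP : IsStarProjection P) : A ∈ corner P ↔ P * A * P = A := by
  constructor
  · rintro ⟨B, rfl⟩
    dsimp only
    have : P * (P * B * P) * P = (P * P) * B * (P * P) := by simp only [mul_assoc]
    rw [this, hP.mul_self]
  · intro h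
    exact ⟨A, h⟩

theorem sub_of_mul_eq (hP : IsStarProjection P) (hQ : IsStarProjection Q) (h : P * Q = Q) :
    IsStarProjection (P - Q) := by
  have h' : Q * P = Q := by
    have := congrArg Matrix.conjTranspose h
    rwa [Matrix.conjTranspose_mul, hP.conjTranspose_eq, hQ.conjTranspose_eq] at this
  refine ⟨?_, ?_⟩
  · change (P - Q) * (P - Q) = P - Q
    rw [mul_sub, sub_mul, sub_mul, h, h', hP.mul_self, hQ.mul_self]
    abel
  · change (P - Q)ᴴ = P - Q
    rw [Matrix.conjTranspose_sub, hP.conjTranspose_eq, hQ.conjTranspose_eq]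

/-- An orthogonal projection is `V V†` for an isometry `V` from a space of dimension its rank. -/
theorem exists_isometry (hP : IsStarProjection P) :
    ∃ V : Matrix (Fin d) (Fin P.rank) ℂ, Vᴴ * V = 1 ∧ V * Vᴴ = P := by
  have hH : P.IsHermitian := hP.conjTranspose_eq
  have hcard := hH.rank_eq_card_non_zero_eigs
  obtain ⟨e⟩ : Nonempty (Fin P.rank ≃ {i // hH.eigenvalues i ≠ 0}) :=
    ⟨(finCongr hcard).trans (Fintype.equivFin _).symm⟩
  set U : MatC d := (hH.eigenvectorUnitary : MatC d)
  have hU : Uᴴ * U = 1 := Matrix.mem_unitaryGroup_left hH.eigenvectorUnitary.2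
  have hU' : U * Uᴴ = 1 := Matrix.mem_unitaryGroup_right hH.eigenvectorUnitary.2
  have hsp : P = U * Matrix.diagonal (fun i => (hH.eigenvalues i : ℂ)) * Uᴴ := by
    conv_lhs => rw [hH.spectral_theorem, Unitary.conjStarAlgAut_apply]
    rfl
  -- In the eigenbasis idempotence holds eigenvalue by eigenvalue.
  have hev : ∀ i, hH.eigenvalues i ≠ 0 → hH.eigenvalues i = 1 := by
    intro i hi
    have h1 : Uᴴ * P * U = Matrix.diagonal (fun i => (hH.eigenvalues i : ℂ)) := by
      calc Uᴴ * P * U = (Uᴴ * U) * Matrix.diagonal (fun i => (hH.eigenvalues i : ℂ)) * (Uᴴ * U) := by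
            conv_lhs => rw [hsp]
            simp only [mul_assoc]
        _ = _ := by rw [hU]; simp
    have h2 : (Uᴴ * P * U) * (Uᴴ * P * U) = Uᴴ * P * U := by
      calc (Uᴴ * P * U) * (Uᴴ * P * U) = Uᴴ * (P * (U * Uᴴ) * P) * U := by
            simp only [mul_assoc]
        _ = _ := by rw [hU', mul_one, hP.mul_self]
    rw [h1, Matrix.diagonal_mul_diagonal] at h2
    have h3 := congrFun (Matrix.diagonal_injective h2) i
    have h4 : hH.eigenvalues i * hH.eigenvalues i = hH.eigenvalues i := by exact_mod_cast h3
    exact mul_right_cancel₀ hi (by rw [h4, one_mul])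
  refine ⟨U.submatrix id (fun k => (e k).1), ?_, ?_⟩
  · rw [Matrix.conjTranspose_submatrix, ← Matrix.submatrix_mul _ _ _ _ _ Function.bijective_id, hU]
    ext a b
    simp [Matrix.one_apply, Subtype.ext_iff.symm]
  · conv_rhs => rw [hsp]
    ext a b
    rw [Matrix.mul_apply, Matrix.mul_apply]
    simp only [Matrix.submatrix_apply, id, Matrix.conjTranspose_apply, Matrix.mul_diagonal]
    rw [e.sum_comp (fun k => U a k.1 * star (U b k.1)),
      ← Finset.sum_subtype (Finset.univ.filter fun i => hH.eigenvalues i ≠ 0) (by simp)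
        (fun i => U a i * star (U b i)), Finset.sum_filter]
    refine Finset.sum_congr rfl fun i _ => ?_
    split_ifs with hi
    · simp [hev i hi]
    · simp [not_not.mp hi]

theorem trace_eq_rank (hP : IsStarProjection P) : P.trace = P.rank := by
  obtain ⟨V, hV, hV'⟩ := hP.exists_isometry
  conv_lhs => rw [← hV', Matrix.trace_mul_comm, hV]
  simp

theorem rank_eq_iff (hP : IsStarProjection P) (hQ : IsStarProjection Q) :
    P.rank = Q.rank ↔ P.trace = Q.trace := by
  rw [hP.trace_eq_rank, hQ.trace_eq_rank, Nat.cast_inj]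

theorem eq_one_of_rank (hP : IsStarProjection P) (h : P.rank = d) : P = 1 := by
  have h1 : (1 - P).trace = 0 := by
    rw [Matrix.trace_sub, hP.trace_eq_rank, h]; simp
  exact (sub_eq_zero.mp (hP.one_sub.posSemidef.trace_eq_zero_iff.mp h1)).symm

end IsStarProjection

/-! ### Positive maps, adjoints and corners -/

section PositiveMaps

variable {d : ℕ} {E : MatC d →ₗ[ℂ] MatC d}

theorem eq_of_trace_conjTranspose_mul {M N : MatC d}
    (h : ∀ A : MatC d, (Mᴴ * A).trace = (Nᴴ * A).trace) : M = N :=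
  Matrix.conjTranspose_injective (Matrix.ext_iff_trace_mul_right.mpr h)

theorem IsPositiveMap.map_conjTranspose (hE : IsPositiveMap E) (A : MatC d) :
    E Aᴴ = (E A)ᴴ := by
  have hA : A ∈ Submodule.span ℂ {A : MatC d | A.PosSemidef} := by
    rw [Matrix.PosSemidef.span_eq_top]; trivial
  induction hA using Submodule.span_induction with
  | mem A hA => rw [hA.isHermitian.eq, (hE A hA).isHermitian.eq]
  | zero => simp
  | add A B _ _ hA hB => rw [Matrix.conjTranspose_add, map_add, hA, hB, map_add,
      Matrix.conjTranspose_add]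
  | smul c A _ hA => rw [Matrix.conjTranspose_smul, map_smul, hA, map_smul,
      Matrix.conjTranspose_smul]

theorem IsPositiveMap.isHermitian_hsAdjoint (hE : IsPositiveMap E) {B : MatC d}
    (hB : B.IsHermitian) : (hsAdjoint E B).IsHermitian := by
  refine eq_of_trace_conjTranspose_mul fun A => ?_
  rw [trace_hsAdjoint_conjTranspose_mul, Matrix.conjTranspose_conjTranspose]
  have h := trace_hsAdjoint_conjTranspose_mul E B Aᴴ
  rw [hE.map_conjTranspose, ← Matrix.conjTranspose_mul, ← Matrix.conjTranspose_mul,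
    Matrix.trace_conjTranspose, Matrix.trace_conjTranspose, star_inj] at h
  rw [Matrix.trace_mul_comm (hsAdjoint E B) A, h, hB.eq, Matrix.trace_mul_comm]

theorem IsPositiveMap.trace_hsAdjoint_mul (hE : IsPositiveMap E) {B : MatC d}
    (hB : B.IsHermitian) (A : MatC d) : (hsAdjoint E B * A).trace = (B * E A).trace := by
  have h := trace_hsAdjoint_conjTranspose_mul E B A
  rwa [(hE.isHermitian_hsAdjoint hB).eq, hB.eq] at h

/-- Duality on rank-one matrices: x† E*(B) x = tr(B E(xx†)), the trace of a product of two positive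
matrices. -/
theorem IsPositiveMap.hsAdjoint (hE : IsPositiveMap E) : IsPositiveMap (hsAdjoint E) := by
  intro B hB
  refine .of_dotProduct_mulVec_nonneg (hE.isHermitian_hsAdjoint hB.isHermitian) fun x => ?_
  have h : star x ⬝ᵥ (_root_.hsAdjoint E B *ᵥ x)
      = (_root_.hsAdjoint E B * Matrix.vecMulVec x (star x)).trace := by
    rw [Matrix.mul_vecMulVec, Matrix.trace_vecMulVec, dotProduct_comm]
  rw [h, hE.trace_hsAdjoint_mul hB.isHermitian]
  exact hB.trace_mul_nonneg (hE _ (Matrix.posSemidef_vecMulVec_self_star x))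

theorem scaledMap_apply (E : MatC d →ₗ[ℂ] MatC d) (X Y A : MatC d) :
    scaledMap E X Y A = Yᴴ * E (X * A * Xᴴ) * Y := rfl

theorem hsAdjoint_scaledMap (E : MatC d →ₗ[ℂ] MatC d) (X Y B : MatC d) :
    hsAdjoint (scaledMap E X Y) B = Xᴴ * hsAdjoint E (Y * B * Yᴴ) * X := by
  refine eq_of_trace_conjTranspose_mul fun A => ?_
  rw [trace_hsAdjoint_conjTranspose_mul, scaledMap_apply]
  calc (Bᴴ * (Yᴴ * E (X * A * Xᴴ) * Y)).trace = ((Y * B * Yᴴ)ᴴ * E (X * A * Xᴴ)).trace := by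
        simp only [Matrix.conjTranspose_mul, Matrix.conjTranspose_conjTranspose]
        rw [← mul_assoc, Matrix.trace_mul_comm]
        simp only [mul_assoc]
    _ = ((hsAdjoint E (Y * B * Yᴴ))ᴴ * (X * A * Xᴴ)).trace :=
        (trace_hsAdjoint_conjTranspose_mul E _ _).symm
    _ = _ := by
        simp only [Matrix.conjTranspose_mul, Matrix.conjTranspose_conjTranspose]
        rw [← mul_assoc, Matrix.trace_mul_comm]
        simp only [mul_assoc]

theorem scaledMap_scaledMap (E : MatC d →ₗ[ℂ] MatC d) (X Y Z W : MatC d) :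
    scaledMap (scaledMap E X Y) Z W = scaledMap E (X * Z) (Y * W) := by
  ext1 A
  simp only [scaledMap_apply, Matrix.conjTranspose_mul, mul_assoc]

theorem scaledMap_one_one (E : MatC d →ₗ[ℂ] MatC d) : scaledMap E 1 1 = E := by
  ext1 A
  simp [scaledMap_apply]

theorem IsPositiveMap.scaledMap (hE : IsPositiveMap E) (X Y : MatC d) :
    IsPositiveMap (scaledMap E X Y) := fun _ hA =>
  (hE _ (hA.mul_mul_conjTranspose_same X)).conjTranspose_mul_mul_same Y

theorem isScaling_iff (E : MatC d →ₗ[ℂ] MatC d) (X Y : MatC d) :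
    IsScaling E X Y ↔ Yᴴ * E (X * Xᴴ) * Y = 1 ∧ Xᴴ * hsAdjoint E (Y * Yᴴ) * X = 1 := by
  rw [IsScaling, IsDoublyStochasticMap, hsAdjoint_scaledMap, scaledMap_apply, mul_one, mul_one]

theorem IsScaling.isUnit_left {X Y : MatC d} (h : IsScaling E X Y) : IsUnit X :=
  (Matrix.isUnit_iff_isUnit_det _).mpr
    (Matrix.isUnit_det_of_left_inverse ((isScaling_iff E X Y).mp h).2)

theorem IsScaling.isUnit_right {X Y : MatC d} (h : IsScaling E X Y) : IsUnit Y :=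
  (Matrix.isUnit_iff_isUnit_det _).mpr
    (Matrix.isUnit_det_of_left_inverse ((isScaling_iff E X Y).mp h).1)

/-- A positive map sends the corner of `P` to that of `Q` as soon as it does so with `P`. -/
theorem IsPositiveMap.mapsTo_corner_of_mul_eq_zero (hE : IsPositiveMap E) {P Q : MatC d}
    (hP : IsStarProjection P) (hQ : IsStarProjection Q) (h : E P * (1 - Q) = 0) :
    Set.MapsTo E (corner P) (corner Q) := by
  have key : ∀ A : MatC d, E (P * A * P) * (1 - Q) = 0 := by
    intro A
    have hA : A ∈ Submodule.span ℂ {A : MatC d | A.PosSemidef} := by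
      rw [Matrix.PosSemidef.span_eq_top]; trivial
    induction hA using Submodule.span_induction with
    | mem N hN =>
      -- From N ≤ c·1 follows E(PNP) ≤ c E(P), so E(PNP) is also annihilated by 1 - Q. Linearity
      -- then covers all matrices.
      obtain ⟨c, -, hc⟩ := hN.exists_le_smul_one
      have h1 := hc.conjTranspose_mul_mul_same P
      rw [hP.conjTranspose_eq, mul_sub, sub_mul, Matrix.mul_smul, Matrix.smul_mul, mul_one,
        hP.mul_self] at h1
      have h2 := hE _ h1
      rw [map_sub, map_smul] at h2
      have h3 := hN.conjTranspose_mul_mul_same P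
      rw [hP.conjTranspose_eq] at h3
      refine (hE _ h3).mul_eq_zero_of_le h2 hQ.one_sub.posSemidef ?_
      rw [Matrix.smul_mul, h, smul_zero]
    | zero => simp
    | add A B _ _ hA hB => rw [mul_add, add_mul, map_add, add_mul, hA, hB, add_zero]
    | smul c A _ hA => rw [Matrix.mul_smul, Matrix.smul_mul, map_smul, Matrix.smul_mul, hA,
        smul_zero]
  rintro _ ⟨A, rfl⟩
  rw [hQ.mem_corner_iff]
  dsimp only
  have h1 : E (P * A * P) * Q = E (P * A * P) := by
    have := key A
    rw [mul_sub, mul_one, sub_eq_zero] at this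
    exact this.symm
  have h2 : Q * E (P * A * P) = E (P * A * P) := by
    have := key Aᴴ
    have e : P * Aᴴ * P = (P * A * P)ᴴ := by
      simp only [Matrix.conjTranspose_mul, hP.conjTranspose_eq, mul_assoc]
    rw [e, hE.map_conjTranspose, mul_sub, mul_one, sub_eq_zero] at this
    have := congrArg Matrix.conjTranspose this
    rw [Matrix.conjTranspose_mul, Matrix.conjTranspose_conjTranspose, hQ.conjTranspose_eq] at this
    exact this.symm
  rw [h2, h1]

theorem IsPositiveMap.mapsTo_corner_of_trace (hE : IsPositiveMap E) {P Q : MatC d}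
    (hP : IsStarProjection P) (hQ : IsStarProjection Q) (h : (E P * (1 - Q)).trace = 0) :
    Set.MapsTo E (corner P) (corner Q) :=
  hE.mapsTo_corner_of_mul_eq_zero hP hQ
    ((hE P hP.posSemidef).mul_eq_zero_of_trace hQ.one_sub.posSemidef h)

theorem IsPositiveMap.eq_zero_of_map_one (hE : IsPositiveMap E) (h : E 1 = 0) : E = 0 := by
  have h1 := hE.mapsTo_corner_of_mul_eq_zero (P := 1) (Q := 0) (.one _) (.zero _) (by rw [h, zero_mul])
  ext1 A
  have h2 := h1 (⟨A, by simp⟩ : A ∈ corner 1)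
  obtain ⟨B, hB⟩ := h2
  simpa using hB.symm

theorem self_mem_corner {P : MatC d} (hP : IsStarProjection P) : P ∈ corner P := by
  rw [hP.mem_corner_iff, hP.mul_self, hP.mul_self]

theorem IsDoublyStochasticMap.trace_map (hds : IsDoublyStochasticMap E) (hE : IsPositiveMap E)
    (A : MatC d) : (E A).trace = A.trace := by
  have h := hE.trace_hsAdjoint_mul Matrix.isHermitian_one A
  rwa [hds.2, one_mul, one_mul, eq_comm] at h

/-- Compressing E(1 - P) ≥ 0 by Q shows Q - E(P) ≥ 0; trace preservation and equal ranks give this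
difference trace zero. -/
theorem IsDoublyStochasticMap.map_eq_of_mapsTo (hds : IsDoublyStochasticMap E) (hE : IsPositiveMap E)
    {P Q : MatC d} (hP : IsStarProjection P) (hQ : IsStarProjection Q)
    (hr : P.rank = Q.rank) (hm : Set.MapsTo E (corner P) (corner Q)) : E P = Q := by
  have h1 : Q * E P * Q = E P := hQ.mem_corner_iff.mp (hm (self_mem_corner hP))
  have h2 := (hE _ hP.one_sub.posSemidef).conjTranspose_mul_mul_same Q
  rw [map_sub, hds.1, hQ.conjTranspose_eq, mul_sub, sub_mul, h1, mul_one, hQ.mul_self] at h2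
  have h3 : (Q - E P).trace = 0 := by
    rw [Matrix.trace_sub, hds.trace_map hE, (hP.rank_eq_iff hQ).mp hr, sub_self]
  exact (sub_eq_zero.mp (h2.trace_eq_zero_iff.mp h3)).symm

theorem IsPositiveMap.mapsTo_corner_of_map_eq (hE : IsPositiveMap E) {P Q : MatC d}
    (hP : IsStarProjection P) (hQ : IsStarProjection Q)
    (h : E P = Q) : Set.MapsTo E (corner P) (corner Q) :=
  hE.mapsTo_corner_of_mul_eq_zero hP hQ (by rw [h, hQ.mul_one_sub_self])

/-- By duality E*(Q) has no overlap with 1 - P, and E*(1 - Q) none with P; unitality of E* combines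
the two. -/
theorem IsDoublyStochasticMap.hsAdjoint_eq_of_map_eq (hds : IsDoublyStochasticMap E) (hE : IsPositiveMap E)
    {P Q : MatC d} (hP : IsStarProjection P) (hQ : IsStarProjection Q) (h : E P = Q) : hsAdjoint E Q = P := by
  have h1 : hsAdjoint E Q * (1 - P) = 0 := by
    refine (hE.hsAdjoint _ hQ.posSemidef).mul_eq_zero_of_trace hP.one_sub.posSemidef ?_
    rw [hE.trace_hsAdjoint_mul hQ.posSemidef.isHermitian, map_sub, hds.1, h, hQ.mul_one_sub_self,
      Matrix.trace_zero]
  have h2 : hsAdjoint E (1 - Q) * P = 0 := by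
    refine (hE.hsAdjoint _ hQ.one_sub.posSemidef).mul_eq_zero_of_trace hP.posSemidef ?_
    rw [hE.trace_hsAdjoint_mul hQ.one_sub.posSemidef.isHermitian, h, hQ.one_sub_mul_self,
      Matrix.trace_zero]
  rw [map_sub, hds.2, sub_mul, one_mul, sub_eq_zero] at h2
  rw [mul_sub, mul_one, sub_eq_zero] at h1
  rw [h1, ← h2]

end PositiveMaps

/-! ### Invariance of full indecomposability under invertible scalings -/

/-- The orthogonal projection onto the range of a matrix. -/
theorem exists_range_projection {d : ℕ} (M : MatC d) :
    ∃ P : MatC d, IsStarProjection P ∧ P * M = M ∧ ∃ C, P = M * C := by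
  have hH := Matrix.isHermitian_mul_conjTranspose_self M
  obtain ⟨U, hU, a, ha⟩ := hH.exists_unitary_diagonal
  have hU1 := Matrix.mem_unitaryGroup_left hU
  have key : ∀ b c : Fin d → ℂ, (U * Matrix.diagonal b * Uᴴ) * (U * Matrix.diagonal c * Uᴴ)
      = U * Matrix.diagonal (fun i => b i * c i) * Uᴴ := by
    intro b c
    calc _ = U * Matrix.diagonal b * (Uᴴ * U) * Matrix.diagonal c * Uᴴ := by
          simp only [mul_assoc]
      _ = _ := by rw [hU1, mul_one, mul_assoc U, Matrix.diagonal_mul_diagonal]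
  set P : MatC d := U * Matrix.diagonal (fun i => if a i = 0 then (0 : ℂ) else 1) * Uᴴ with hPdef
  have hP : IsStarProjection P := by
    refine ⟨?_, ?_⟩
    · change P * P = P
      rw [hPdef, key]
      congr 3
      ext i
      split_ifs <;> simp
    · change Pᴴ = P
      rw [hPdef, Matrix.conjTranspose_mul, Matrix.conjTranspose_mul,
        Matrix.conjTranspose_conjTranspose, Matrix.diagonal_conjTranspose, mul_assoc]
      congr 3
      ext i
      simp only [Pi.star_apply]
      split_ifs <;> simp
  -- The witness is `Mᴴ` times the pseudoinverse of `M * Mᴴ`; the convention `0⁻¹ = 0` handles the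
  -- kernel.
  refine ⟨P, hP, ?_, Mᴴ * (U * Matrix.diagonal (fun i => ((a i : ℂ))⁻¹) * Uᴴ), ?_⟩
  · have h1 : (1 - P) * (M * Mᴴ) = 0 := by
      rw [sub_mul, one_mul, ha, hPdef, key, sub_eq_zero]
      congr 3
      ext i
      split_ifs with h <;> simp [h]
    have h2 : ((1 - P) * M) * ((1 - P) * M)ᴴ = 0 := by
      rw [Matrix.conjTranspose_mul, ← mul_assoc, mul_assoc (1 - P), h1, zero_mul]
    have h3 := Matrix.self_mul_conjTranspose_eq_zero.mp h2
    rw [sub_mul, one_mul, sub_eq_zero] at h3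
    exact h3.symm
  · rw [← mul_assoc, ha, key, hPdef]
    congr 3
    ext i
    split_ifs with h
    · simp [h]
    · rw [mul_inv_cancel₀ (by exact_mod_cast h)]

theorem IsFullyIndecomposable.scaledMap {d : ℕ} {E : MatC d →ₗ[ℂ] MatC d}
    (h : IsFullyIndecomposable E) {X Y : MatC d} (hX : IsUnit X) (hY : IsUnit Y) :
    IsFullyIndecomposable (scaledMap E X Y) := by
  obtain ⟨X', hX1, hX2⟩ := isUnit_iff_exists.mp hX
  obtain ⟨Y', hY1, hY2⟩ := isUnit_iff_exists.mp hY
  have hX1' : X'ᴴ * Xᴴ = 1 := by rw [← Matrix.conjTranspose_mul, hX1, Matrix.conjTranspose_one]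
  have hX2' : Xᴴ * X'ᴴ = 1 := by rw [← Matrix.conjTranspose_mul, hX2, Matrix.conjTranspose_one]
  have hY1' : Y'ᴴ * Yᴴ = 1 := by rw [← Matrix.conjTranspose_mul, hY1, Matrix.conjTranspose_one]
  have hY2' : Yᴴ * Y'ᴴ = 1 := by rw [← Matrix.conjTranspose_mul, hY2, Matrix.conjTranspose_one]
  have hinv : ∀ A, E (X * A * Xᴴ) = Y'ᴴ * _root_.scaledMap E X Y A * Y' := by
    intro A
    rw [scaledMap_apply]
    calc _ = (Y'ᴴ * Yᴴ) * E (X * A * Xᴴ) * (Y * Y') := by rw [hY1', hY1, one_mul, mul_one]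
      _ = _ := by simp only [mul_assoc]
  refine ⟨?_, ?_⟩
  · intro h0
    refine h.1 (LinearMap.ext fun A => ?_)
    have h1 := hinv (X' * A * X'ᴴ)
    rw [h0, LinearMap.zero_apply, mul_zero, zero_mul] at h1
    rw [LinearMap.zero_apply, ← h1]
    congr 1
    calc A = (X * X') * A * (X'ᴴ * Xᴴ) := by rw [hX1, hX1', one_mul, mul_one]
      _ = _ := by simp only [mul_assoc]
  · intro P Q hP hQ hP0 hQ0 hr hm
    -- Invertible matrices preserve dimensions but not orthogonality, so projections are transported
    -- through the subspaces XP and Y'†Q, where Y' is the inverse of Y.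
    obtain ⟨P', hP', hP'm, C, hC⟩ := exists_range_projection (X * P)
    obtain ⟨Q', hQ', hQ'm, D, hD⟩ := exists_range_projection (Y'ᴴ * Q)
    have hrP : P'.rank = P.rank := by
      apply le_antisymm
      · rw [hC]
        exact (Matrix.rank_mul_le_left _ _).trans (Matrix.rank_mul_le_right _ _)
      · have e : P = X' * (P' * (X * P)) := by rw [hP'm, ← mul_assoc, hX2, one_mul]
        conv_lhs => rw [e]
        exact (Matrix.rank_mul_le_right _ _).trans (Matrix.rank_mul_le_left _ _)
    have hrQ : Q'.rank = Q.rank := by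
      apply le_antisymm
      · rw [hD]
        exact (Matrix.rank_mul_le_left _ _).trans (Matrix.rank_mul_le_right _ _)
      · have e : Q = Yᴴ * (Q' * (Y'ᴴ * Q)) := by rw [hQ'm, ← mul_assoc, hY2', one_mul]
        conv_lhs => rw [e]
        exact (Matrix.rank_mul_le_right _ _).trans (Matrix.rank_mul_le_left _ _)
    have hP'0 : P' ≠ 0 := by
      rintro rfl
      rw [zero_mul] at hP'm
      apply hP0
      rw [← one_mul P, ← hX2, mul_assoc, ← hP'm, mul_zero]
    have hQ'0 : Q' ≠ 0 := by
      rintro rfl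
      rw [zero_mul] at hQ'm
      apply hQ0
      rw [← one_mul Q, ← hY2', mul_assoc, ← hQ'm, mul_zero]
    have hm' : Set.MapsTo E (corner P') (corner Q') := by
      rintro _ ⟨A, rfl⟩
      dsimp only
      have e1 : P' * A * P' = X * (P * (C * A * Cᴴ) * P) * Xᴴ := by
        conv_lhs => rw [← hP'.conjTranspose_eq]
        conv_lhs => enter [2]; rw [hC]
        conv_lhs => enter [1, 1]; rw [hP'.conjTranspose_eq, hC]
        simp only [Matrix.conjTranspose_mul, hP.conjTranspose_eq, mul_assoc]
      rw [hQ'.mem_corner_iff, e1, hinv]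
      obtain ⟨B, hB⟩ := hm ⟨C * A * Cᴴ, rfl⟩
      dsimp only at hB
      rw [← hB]
      have hQ'm' : Q * Y' * Q' = Q * Y' := by
        have := congrArg Matrix.conjTranspose hQ'm
        simpa only [Matrix.conjTranspose_mul, hQ.conjTranspose_eq, hQ'.conjTranspose_eq,
          Matrix.conjTranspose_conjTranspose] using this
      calc Q' * (Y'ᴴ * (Q * B * Q) * Y') * Q' = (Q' * (Y'ᴴ * Q)) * B * (Q * Y' * Q') := by
            simp only [mul_assoc]
        _ = _ := by rw [hQ'm, hQ'm']; simp only [mul_assoc]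
    obtain ⟨h1, h2⟩ := h.2 P' Q' hP' hQ' hP'0 hQ'0 (by rw [hrP, hrQ, hr]) hm'
    refine ⟨hP.eq_one_of_rank ?_, hQ.eq_one_of_rank ?_⟩
    · rw [← hrP, h1, Matrix.rank_one, Fintype.card_fin]
    · rw [← hrQ, h2, Matrix.rank_one, Fintype.card_fin]

/-! ### Spectral coordinates -/

/-- The Hermitian matrix with eigenvectors the columns of `U` and eigenvalues `a`. -/
def unitaryDiag {d : ℕ} (U : MatC d) (a : Fin d → ℝ) : MatC d :=
  U * Matrix.diagonal (fun i => (a i : ℂ)) * Uᴴ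

/-- The weight that `E` transports from the `j`-th column of `U` to the `i`-th column of `W`. -/
def transportWeight {d : ℕ} (E : MatC d →ₗ[ℂ] MatC d) (U W : MatC d) (i j : Fin d) : ℝ :=
  ((Wᴴ * E (unitaryDiag U (Pi.single j 1)) * W) i i).re

section UnitaryDiag

variable {d : ℕ} {U : MatC d}

theorem unitaryDiag_mul (hU : U ∈ Matrix.unitaryGroup (Fin d) ℂ) (a b : Fin d → ℝ) :
    unitaryDiag U a * unitaryDiag U b = unitaryDiag U (a * b) := by
  unfold unitaryDiag
  calc _ = U * Matrix.diagonal (fun i => (a i : ℂ)) * (Uᴴ * U) *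
        Matrix.diagonal (fun i => (b i : ℂ)) * Uᴴ := by simp only [mul_assoc]
    _ = _ := by
      rw [Matrix.mem_unitaryGroup_left hU, mul_one, mul_assoc U, Matrix.diagonal_mul_diagonal]
      simp

theorem unitaryDiag_one (hU : U ∈ Matrix.unitaryGroup (Fin d) ℂ) : unitaryDiag U 1 = 1 := by
  simp [unitaryDiag, Matrix.mem_unitaryGroup_right hU]

theorem unitaryDiag_const (hU : U ∈ Matrix.unitaryGroup (Fin d) ℂ) (c : ℝ) :
    unitaryDiag U (fun _ => c) = (c : ℂ) • 1 := by
  rw [unitaryDiag, ← Matrix.smul_one_eq_diagonal, Matrix.mul_smul, Matrix.smul_mul, mul_one,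
    Matrix.mem_unitaryGroup_right hU]

theorem unitaryDiag_sub (U : MatC d) (a b : Fin d → ℝ) :
    unitaryDiag U (a - b) = unitaryDiag U a - unitaryDiag U b := by
  simp only [unitaryDiag, ← mul_sub, ← sub_mul, ← Matrix.diagonal_sub, Pi.sub_apply,
    Complex.ofReal_sub]

theorem unitaryDiag_eq_sum (U : MatC d) (a : Fin d → ℝ) :
    unitaryDiag U a = ∑ j, (a j : ℂ) • unitaryDiag U (Pi.single j 1) := by
  have : Matrix.diagonal (fun i => (a i : ℂ)) = ∑ j, (a j : ℂ) •
      Matrix.diagonal (fun i => (((Pi.single j 1 : Fin d → ℝ) i : ℝ) : ℂ)) := by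
    ext r s
    rw [Matrix.sum_apply]
    simp only [Matrix.smul_apply, Matrix.diagonal_apply, smul_eq_mul]
    split_ifs with h
    · simp [Pi.single_apply, apply_ite (Complex.ofReal)]
    · simp
  rw [unitaryDiag, this, Finset.mul_sum, Finset.sum_mul]
  simp only [unitaryDiag, Matrix.mul_smul, Matrix.smul_mul]

theorem posSemidef_unitaryDiag (U : MatC d) {a : Fin d → ℝ} (ha : ∀ i, 0 ≤ a i) :
    (unitaryDiag U a).PosSemidef :=
  (Matrix.PosSemidef.diagonal fun i => by simpa using ha i).mul_mul_conjTranspose_same U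

theorem conjTranspose_mul_unitaryDiag_mul (hU : U ∈ Matrix.unitaryGroup (Fin d) ℂ)
    (a : Fin d → ℝ) : Uᴴ * unitaryDiag U a * U = Matrix.diagonal (fun i => (a i : ℂ)) := by
  unfold unitaryDiag
  calc _ = (Uᴴ * U) * Matrix.diagonal (fun i => (a i : ℂ)) * (Uᴴ * U) := by
        simp only [mul_assoc]
    _ = _ := by rw [Matrix.mem_unitaryGroup_left hU, one_mul, mul_one]

theorem nonneg_of_posSemidef_unitaryDiag (hU : U ∈ Matrix.unitaryGroup (Fin d) ℂ) {a : Fin d → ℝ}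
    (h : (unitaryDiag U a).PosSemidef) (i : Fin d) : 0 ≤ a i := by
  have h1 := (h.conjTranspose_mul_mul_same U).diag_nonneg (i := i)
  rw [conjTranspose_mul_unitaryDiag_mul hU, Matrix.diagonal_apply_eq] at h1
  exact_mod_cast h1

theorem trace_unitaryDiag (hU : U ∈ Matrix.unitaryGroup (Fin d) ℂ) (a : Fin d → ℝ) :
    (unitaryDiag U a).trace = ∑ i, (a i : ℂ) := by
  rw [unitaryDiag, Matrix.trace_mul_comm, ← mul_assoc, Matrix.mem_unitaryGroup_left hU, one_mul,
    Matrix.trace_diagonal]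

theorem det_unitaryDiag (hU : U ∈ Matrix.unitaryGroup (Fin d) ℂ) (a : Fin d → ℝ) :
    (unitaryDiag U a).det = ((∏ i, a i : ℝ) : ℂ) := by
  have h : U.det * Uᴴ.det = 1 := by
    rw [← Matrix.det_mul, Matrix.mem_unitaryGroup_right hU, Matrix.det_one]
  rw [unitaryDiag, Matrix.det_mul, Matrix.det_mul, mul_right_comm, h, one_mul, Matrix.det_diagonal,
    Complex.ofReal_prod]

theorem norm_unitaryDiag_apply_le (hU : U ∈ Matrix.unitaryGroup (Fin d) ℂ) {a : Fin d → ℝ} {C : ℝ}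
    (ha : ∀ i, 0 ≤ a i) (haC : ∀ i, a i ≤ C) (r s : Fin d) : ‖unitaryDiag U a r s‖ ≤ d * C := by
  rw [unitaryDiag, Matrix.mul_apply]
  refine (norm_sum_le _ _).trans ?_
  have : ∀ i ∈ (Finset.univ : Finset (Fin d)),
      ‖(U * Matrix.diagonal (fun i => (a i : ℂ))) r i * Uᴴ i s‖ ≤ C := by
    intro i _
    rw [Matrix.mul_diagonal, norm_mul, norm_mul, Matrix.conjTranspose_apply, norm_star,
      Complex.norm_real, Real.norm_of_nonneg (ha i)]
    have h1 := entry_norm_bound_of_unitary hU r i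
    have h2 := entry_norm_bound_of_unitary hU s i
    calc ‖U r i‖ * a i * ‖U s i‖ ≤ 1 * a i * 1 := by gcongr; exact mul_nonneg zero_le_one (ha i); exact ha i
      _ ≤ C := by simpa using haC i
  refine (Finset.sum_le_sum this).trans ?_
  simp

theorem isStarProjection_unitaryDiag (hU : U ∈ Matrix.unitaryGroup (Fin d) ℂ)
    (J : Finset (Fin d)) : IsStarProjection (unitaryDiag U (fun j => if j ∈ J then 1 else 0)) := by
  refine ⟨?_, ?_⟩
  · change _ * _ = _
    rw [unitaryDiag_mul hU]
    congr 1
    ext j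
    by_cases hj : j ∈ J <;> simp [hj]
  · exact (posSemidef_unitaryDiag U fun i => by split_ifs <;> simp).isHermitian

theorem rank_unitaryDiag (hU : U ∈ Matrix.unitaryGroup (Fin d) ℂ) (J : Finset (Fin d)) :
    (unitaryDiag U (fun j => if j ∈ J then 1 else 0)).rank = J.card := by
  have h := (isStarProjection_unitaryDiag hU J).trace_eq_rank
  rw [trace_unitaryDiag hU] at h
  have h2 : ∑ j, (((if j ∈ J then 1 else 0 : ℝ)) : ℂ) = J.card := by
    simp [apply_ite (Complex.ofReal)]
  exact Nat.cast_injective (h.symm.trans h2)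

theorem Matrix.IsHermitian.exists_unitaryDiag {A : MatC d} (hA : A.IsHermitian) :
    ∃ U ∈ Matrix.unitaryGroup (Fin d) ℂ, ∃ a : Fin d → ℝ, A = unitaryDiag U a :=
  hA.exists_unitary_diagonal

theorem submatrix_mem_unitaryGroup (hU : U ∈ Matrix.unitaryGroup (Fin d) ℂ)
    (σ : Equiv.Perm (Fin d)) : U.submatrix id σ ∈ Matrix.unitaryGroup (Fin d) ℂ := by
  rw [Matrix.mem_unitaryGroup_iff']
  change (U.submatrix id σ)ᴴ * _ = 1
  rw [Matrix.conjTranspose_submatrix, ← Matrix.submatrix_mul _ _ _ _ _ Function.bijective_id,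
    Matrix.mem_unitaryGroup_left hU, Matrix.submatrix_one_equiv]

theorem unitaryDiag_submatrix (U : MatC d) (a : Fin d → ℝ) (σ : Equiv.Perm (Fin d)) :
    unitaryDiag (U.submatrix id σ) (a ∘ σ) = unitaryDiag U a := by
  ext r s
  simp only [unitaryDiag]
  rw [Matrix.mul_apply, Matrix.mul_apply]
  simp only [Matrix.mul_diagonal, Matrix.conjTranspose_apply, Matrix.submatrix_apply, id,
    Function.comp_apply]
  exact Equiv.sum_comp σ fun i => U r i * (a i : ℂ) * star (U s i)

theorem Matrix.IsHermitian.exists_unitaryDiag_monotone {A : MatC d} (hA : A.IsHermitian) :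
    ∃ U ∈ Matrix.unitaryGroup (Fin d) ℂ, ∃ a : Fin d → ℝ, Monotone a ∧ A = unitaryDiag U a := by
  obtain ⟨U, hU, a, rfl⟩ := hA.exists_unitaryDiag
  exact ⟨_, submatrix_mem_unitaryGroup hU (Tuple.sort a), _, Tuple.monotone_sort a,
    (unitaryDiag_submatrix U a _).symm⟩

theorem Matrix.IsHermitian.exists_unitaryDiag_antitone {A : MatC d} (hA : A.IsHermitian) :
    ∃ U ∈ Matrix.unitaryGroup (Fin d) ℂ, ∃ a : Fin d → ℝ, Antitone a ∧ A = unitaryDiag U a := by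
  obtain ⟨U, hU, a, ha, rfl⟩ := hA.exists_unitaryDiag_monotone
  exact ⟨_, submatrix_mem_unitaryGroup hU Fin.revPerm, _,
    fun i j hij => ha (Fin.rev_le_rev.mpr hij), (unitaryDiag_submatrix U a _).symm⟩

end UnitaryDiag

/-! ### Transport weights between orthonormal bases -/

section TransportWeight

variable {d : ℕ} {E : MatC d →ₗ[ℂ] MatC d} {U W : MatC d}

theorem IsPositiveMap.coe_transportWeight (hE : IsPositiveMap E) (U W : MatC d) (i j : Fin d) :
    (transportWeight E U W i j : ℂ) =
      (Wᴴ * E (unitaryDiag U (Pi.single j 1)) * W) i i ∧ 0 ≤ transportWeight E U W i j := by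
  have h0 : (unitaryDiag U (Pi.single j 1)).PosSemidef :=
    posSemidef_unitaryDiag U fun i => by
      rw [Pi.single_apply]; split_ifs <;> simp
  have h := ((hE _ h0).conjTranspose_mul_mul_same W).diag_nonneg (i := i)
  refine ⟨?_, (Complex.nonneg_iff.mp h).1⟩
  exact (Complex.ext rfl (Complex.nonneg_iff.mp h).2)

theorem IsPositiveMap.transportWeight_nonneg (hE : IsPositiveMap E) (U W : MatC d) (i j : Fin d) :
    0 ≤ transportWeight E U W i j := (hE.coe_transportWeight U W i j).2

theorem IsPositiveMap.diag_map_unitaryDiag (hE : IsPositiveMap E) (U W : MatC d) (a : Fin d → ℝ)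
    (i : Fin d) : (Wᴴ * E (unitaryDiag U a) * W) i i =
      ((∑ j, a j * transportWeight E U W i j : ℝ) : ℂ) := by
  rw [unitaryDiag_eq_sum, map_sum, Finset.mul_sum, Finset.sum_mul, Matrix.sum_apply]
  push_cast
  refine Finset.sum_congr rfl fun j _ => ?_
  rw [(hE.coe_transportWeight U W i j).1, map_smul, Matrix.mul_smul, Matrix.smul_mul,
    Matrix.smul_apply, smul_eq_mul]

theorem trace_unitaryDiag_mul (W : MatC d) (b : Fin d → ℝ) (M : MatC d) :
    (unitaryDiag W b * M).trace = ∑ i, (b i : ℂ) * (Wᴴ * M * W) i i := by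
  rw [unitaryDiag, mul_assoc, Matrix.trace_mul_comm, ← mul_assoc, Matrix.trace]
  refine Finset.sum_congr rfl fun i _ => ?_
  rw [Matrix.diag_apply, Matrix.mul_diagonal, mul_comm]

theorem IsPositiveMap.trace_unitaryDiag_mul_map (hE : IsPositiveMap E) (U W : MatC d)
    (a b : Fin d → ℝ) : (unitaryDiag W b * E (unitaryDiag U a)).trace =
      ((∑ i, ∑ j, b i * a j * transportWeight E U W i j : ℝ) : ℂ) := by
  rw [trace_unitaryDiag_mul]
  push_cast
  refine Finset.sum_congr rfl fun i _ => ?_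
  rw [hE.diag_map_unitaryDiag]
  push_cast
  rw [Finset.mul_sum]
  simp only [mul_assoc]

/-- Index sets span coordinate projections of the same rank, and vanishing weights say that
tr(E(P)(1 - Q)) = 0. Thus the array of weights inherits full indecomposability, whatever the two
bases. -/
theorem IsFullyIndecomposable.eq_univ_of_transportWeight (hE : IsPositiveMap E)
    (h : IsFullyIndecomposable E) (hU : U ∈ Matrix.unitaryGroup (Fin d) ℂ)
    (hW : W ∈ Matrix.unitaryGroup (Fin d) ℂ) {J I : Finset (Fin d)} (hJ : J.Nonempty)
    (hIJ : J.card = I.card) (h0 : ∀ j ∈ J, ∀ i ∉ I, transportWeight E U W i j = 0) :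
    J = Finset.univ ∧ I = Finset.univ := by
  have hP := isStarProjection_unitaryDiag hU J
  have hQ := isStarProjection_unitaryDiag hW I
  have hd := h.2 _ _ hP hQ ?_ ?_ ?_ ?_
  · have h1 := rank_unitaryDiag hU J
    have h2 := rank_unitaryDiag hW I
    rw [hd.1, Matrix.rank_one] at h1
    rw [hd.2, Matrix.rank_one] at h2
    exact ⟨(Finset.card_eq_iff_eq_univ J).mp h1.symm, (Finset.card_eq_iff_eq_univ I).mp h2.symm⟩
  · intro h0
    have h1 := rank_unitaryDiag hU J
    rw [h0, Matrix.rank_zero] at h1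
    exact hJ.card_pos.ne h1
  · intro h0
    have h1 := rank_unitaryDiag hW I
    rw [h0, Matrix.rank_zero, ← hIJ] at h1
    exact hJ.card_pos.ne h1
  · rw [rank_unitaryDiag hU, rank_unitaryDiag hW, hIJ]
  · refine hE.mapsTo_corner_of_trace hP hQ ?_
    rw [Matrix.trace_mul_comm, ← unitaryDiag_one hW, ← unitaryDiag_sub,
      hE.trace_unitaryDiag_mul_map, Complex.ofReal_eq_zero]
    refine Finset.sum_eq_zero fun i _ => Finset.sum_eq_zero fun j _ => ?_
    by_cases hi : i ∈ I
    · simp [hi]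
    · by_cases hj : j ∈ J
      · rw [h0 j hj i hi, mul_zero]
      · simp [hj]

theorem IsFullyIndecomposable.sum_transportWeight_pos (hE : IsPositiveMap E)
    (h : IsFullyIndecomposable E) (hU : U ∈ Matrix.unitaryGroup (Fin d) ℂ)
    (hW : W ∈ Matrix.unitaryGroup (Fin d) ℂ) {J : Finset (Fin d)} (hJ : J.Nonempty)
    (hJ' : J ≠ Finset.univ) : 0 < ∑ i ∈ Jᶜ, ∑ j ∈ J, transportWeight E U W i j := by
  have hnn : ∀ i ∈ Jᶜ, 0 ≤ ∑ j ∈ J, transportWeight E U W i j := fun i _ =>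
    Finset.sum_nonneg fun j _ => hE.transportWeight_nonneg U W i j
  refine lt_of_le_of_ne (Finset.sum_nonneg hnn) fun h0 => hJ' ?_
  refine (h.eq_univ_of_transportWeight hE hU hW hJ (I := J) rfl fun j hj i hi => ?_).1
  have h1 := (Finset.sum_eq_zero_iff_of_nonneg hnn).mp h0.symm i (by simpa using hi)
  exact (Finset.sum_eq_zero_iff_of_nonneg
    fun j _ => hE.transportWeight_nonneg U W i j).mp h1 j hj

end TransportWeight

/-! ### Compactness and attainment of the capacity -/

section Compactness

variable {d : ℕ}

theorem isCompact_entrywise_closedBall (d : ℕ) (R : ℝ) :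
    IsCompact {A : MatC d | ∀ i j, ‖A i j‖ ≤ R} := by
  have h : IsCompact (Set.univ.pi fun _ : Fin d => Set.univ.pi fun _ : Fin d =>
      Metric.closedBall (0 : ℂ) R) :=
    isCompact_univ_pi fun _ => isCompact_univ_pi fun _ => isCompact_closedBall _ _
  have e : {A : MatC d | ∀ i j, ‖A i j‖ ≤ R} = Set.univ.pi fun _ : Fin d =>
      Set.univ.pi fun _ : Fin d => Metric.closedBall (0 : ℂ) R := by
    refine Set.ext fun A => ⟨fun h i _ j _ => ?_, fun h i j => ?_⟩
    · exact mem_closedBall_zero_iff.mpr (h i j)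
    · exact mem_closedBall_zero_iff.mp (h i trivial j trivial)
  rw [e]
  exact h

theorem isCompact_unitaryGroup (d : ℕ) :
    IsCompact {U : MatC d | U ∈ Matrix.unitaryGroup (Fin d) ℂ} := by
  refine (isCompact_entrywise_closedBall d 1).of_isClosed_subset ?_
    fun U hU => entry_norm_bound_of_unitary hU
  simp only [Matrix.mem_unitaryGroup_iff]
  exact isClosed_eq (continuous_id.mul continuous_id.star) continuous_const

theorem continuous_transportWeight (E : MatC d →ₗ[ℂ] MatC d) (i j : Fin d) :
    Continuous fun p : MatC d × MatC d => transportWeight E p.1 p.2 i j := by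
  have hE : Continuous E := E.continuous_of_finiteDimensional
  have h1 : Continuous fun p : MatC d × MatC d => unitaryDiag p.1 (Pi.single j 1) :=
    (continuous_fst.mul continuous_const).mul continuous_fst.matrix_conjTranspose
  exact Complex.continuous_re.comp
    (((continuous_snd.matrix_conjTranspose.mul (hE.comp h1)).mul continuous_snd).matrix_elem i i)

/-- For fixed J the escaping weight is continuous and positive on the compact set of pairs of
unitaries, so it has a positive minimum. -/
theorem IsFullyIndecomposable.exists_uniform_bound {E : MatC d →ₗ[ℂ] MatC d}
    (hE : IsPositiveMap E) (h : IsFullyIndecomposable E) :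
    ∃ C : ℝ, 0 ≤ C ∧ ∀ U ∈ Matrix.unitaryGroup (Fin d) ℂ, ∀ W ∈ Matrix.unitaryGroup (Fin d) ℂ,
      ∀ J : Finset (Fin d), J.Nonempty → J ≠ Finset.univ →
        1 ≤ C * ∑ i ∈ Jᶜ, ∑ j ∈ J, transportWeight E U W i j := by
  have key : ∀ J : Finset (Fin d), ∃ C : ℝ, 0 ≤ C ∧ ∀ U ∈ Matrix.unitaryGroup (Fin d) ℂ,
      ∀ W ∈ Matrix.unitaryGroup (Fin d) ℂ, J.Nonempty → J ≠ Finset.univ →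
        1 ≤ C * ∑ i ∈ Jᶜ, ∑ j ∈ J, transportWeight E U W i j := by
    intro J
    by_cases hJ : J.Nonempty ∧ J ≠ Finset.univ
    · have hc : Continuous fun p : MatC d × MatC d =>
          ∑ i ∈ Jᶜ, ∑ j ∈ J, transportWeight E p.1 p.2 i j :=
        continuous_finsetSum _ fun i _ => continuous_finsetSum _ fun j _ =>
          continuous_transportWeight E i j
      obtain ⟨p, hp, hmin⟩ := ((isCompact_unitaryGroup d).prod
        (isCompact_unitaryGroup d)).exists_isMinOn 
          ⟨(1, 1), one_mem (Matrix.unitaryGroup (Fin d) ℂ), one_mem (Matrix.unitaryGroup (Fin d) ℂ)⟩ hc.continuousOn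
      have hpos := h.sum_transportWeight_pos hE hp.1 hp.2 hJ.1 hJ.2
      refine ⟨_, (inv_pos.mpr hpos).le, fun U hU W hW _ _ => ?_⟩
      have := hmin (show (U, W) ∈ _ from ⟨hU, hW⟩)
      rw [inv_mul_eq_div, le_div_iff₀ hpos, one_mul]
      exact this
    · exact ⟨0, le_rfl, fun _ _ _ _ h1 h2 => absurd ⟨h1, h2⟩ hJ⟩
  choose C hC0 hC using key
  -- There are finitely many J; the sum dominates each constant.
  refine ⟨∑ J, C J, Finset.sum_nonneg fun J _ => hC0 J, fun U hU W hW J h1 h2 => ?_⟩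
  refine (hC J U hU W hW h1 h2).trans (mul_le_mul_of_nonneg_right ?_ ?_)
  · exact Finset.single_le_sum (fun J _ => hC0 J) (Finset.mem_univ J)
  · exact (h.sum_transportWeight_pos hE hU hW h1 h2).le

end Compactness

/-- Shifting one product against the other gives 1 = a_n b_0 ∏ a_k b_{k+1}, hence a_n b_0 ≥ M^{-n}.
The smallest values a_n and b_0 are at most 1, so the largest values a_0 and b_n cannot be large. -/
theorem le_pow_of_prod_eq_one {n : ℕ} {a b : Fin (n + 1) → ℝ} {M : ℝ} (ha0 : ∀ i, 0 ≤ a i)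
    (hb0 : ∀ i, 0 ≤ b i) (ha : Antitone a) (hb : Monotone b) (ha1 : ∏ i, a i = 1)
    (hb1 : ∏ i, b i = 1) (hM : 1 ≤ M) (h : ∀ k : Fin n, a k.castSucc * b k.succ ≤ M) :
    (∀ i, a i ≤ M ^ (n + 1)) ∧ ∀ i, b i ≤ M ^ (n + 1) := by
  have hM0 : 0 ≤ M := zero_le_one.trans hM
  have hal : a (Fin.last n) ≤ 1 := by
    by_contra! hlt
    have : 1 < ∏ i, a i := by
      refine lt_of_lt_of_le (one_lt_pow₀ hlt (Nat.succ_ne_zero n)) ?_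
      rw [← Fin.prod_const]
      exact Finset.prod_le_prod (fun i _ => ha0 _) fun i _ => ha (Fin.le_last i)
    exact this.ne' ha1
  have hb0' : b 0 ≤ 1 := by
    by_contra! hlt
    have : 1 < ∏ i, b i := by
      refine lt_of_lt_of_le (one_lt_pow₀ hlt (Nat.succ_ne_zero n)) ?_
      rw [← Fin.prod_const]
      exact Finset.prod_le_prod (fun i _ => hb0 _) fun i _ => hb (Fin.zero_le i)
    exact this.ne' hb1
  have hkey : 1 ≤ a (Fin.last n) * b 0 * M ^ n := by
    have h1 : (∏ i, a i) * ∏ i, b i =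
        a (Fin.last n) * b 0 * ∏ k : Fin n, a k.castSucc * b k.succ := by
      rw [Fin.prod_univ_castSucc a, Fin.prod_univ_succ b, Finset.prod_mul_distrib]; ring
    rw [ha1, hb1, one_mul] at h1
    rw [h1, ← Fin.prod_const]
    exact mul_le_mul_of_nonneg_left (Finset.prod_le_prod
      (fun k _ => mul_nonneg (ha0 _) (hb0 _)) fun k _ => h k) (mul_nonneg (ha0 _) (hb0 _))
  -- For n = 0 there is no index k to use, but then both sequences equal 1. Otherwise monotonicity
  -- compares with the first and the last hypothesis.
  have h0 : a 0 * b 0 ≤ M ∧ a (Fin.last n) * b (Fin.last n) ≤ M := by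
    rcases n with _ | n
    · rw [Fin.prod_univ_one] at ha1 hb1
      have e : Fin.last 0 = 0 := rfl
      rw [e, ha1, hb1]
      simpa using hM
    · refine ⟨le_trans ?_ (h 0), le_trans ?_ (h (Fin.last n))⟩
      · exact mul_le_mul_of_nonneg_left (hb (Fin.zero_le _)) (ha0 _)
      · exact mul_le_mul_of_nonneg_right (ha (Fin.le_last _)) (hb0 _)
  have hMn : 0 ≤ M ^ n := pow_nonneg hM0 n
  refine ⟨fun i => (ha (Fin.zero_le i)).trans ?_, fun i => (hb (Fin.le_last i)).trans ?_⟩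
  · calc a 0 ≤ a 0 * (a (Fin.last n) * b 0 * M ^ n) := le_mul_of_one_le_right (ha0 _) hkey
      _ = a (Fin.last n) * ((a 0 * b 0) * M ^ n) := by ring
      _ ≤ 1 * (M * M ^ n) := by
        gcongr
        · exact mul_nonneg (mul_nonneg (ha0 _) (hb0 _)) hMn
        · exact h0.1
      _ = M ^ (n + 1) := by ring
  · calc b (Fin.last n) ≤ b (Fin.last n) * (a (Fin.last n) * b 0 * M ^ n) :=
          le_mul_of_one_le_right (hb0 _) hkey
      _ = b 0 * ((a (Fin.last n) * b (Fin.last n)) * M ^ n) := by ring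
      _ ≤ 1 * (M * M ^ n) := by
        gcongr
        · exact mul_nonneg (mul_nonneg (ha0 _) (hb0 _)) hMn
        · exact h0.2
      _ = M ^ (n + 1) := by ring

/-- Sublevel sets of `tr (B E(A))` on pairs of positive matrices of determinant one are bounded. -/
theorem IsFullyIndecomposable.exists_entry_bound {n : ℕ} {E : MatC (n + 1) →ₗ[ℂ] MatC (n + 1)}
    (hE : IsPositiveMap E) (h : IsFullyIndecomposable E) (K : ℝ) :
    ∃ R : ℝ, ∀ A B : MatC (n + 1), A.PosSemidef → B.PosSemidef → A.det = 1 → B.det = 1 →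
      (B * E A).trace.re ≤ K → (∀ i j, ‖A i j‖ ≤ R) ∧ ∀ i j, ‖B i j‖ ≤ R := by
  obtain ⟨C, hC0, hC⟩ := h.exists_uniform_bound hE
  -- The eigenvalues are bounded by the power of the maximum; the factor n + 1 passes to matrix
  -- entries.
  refine ⟨(n + 1 : ℕ) * (max 1 (C * K)) ^ (n + 1), fun A B hA hB hA1 hB1 hK => ?_⟩
  obtain ⟨U, hU, a, ha, rfl⟩ := hA.isHermitian.exists_unitaryDiag_antitone
  obtain ⟨W, hW, b, hb, rfl⟩ := hB.isHermitian.exists_unitaryDiag_monotone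
  have ha0 := nonneg_of_posSemidef_unitaryDiag hU hA
  have hb0 := nonneg_of_posSemidef_unitaryDiag hW hB
  rw [det_unitaryDiag hU] at hA1
  rw [det_unitaryDiag hW] at hB1
  rw [hE.trace_unitaryDiag_mul_map, Complex.ofReal_re] at hK
  have hk : ∀ k : Fin n, a k.castSucc * b k.succ ≤ max 1 (C * K) := by
    intro k
    refine le_max_of_le_right ?_
    -- Cut at k: for j ≤ k < i the product b_i a_j is at least b_{k+1} a_k, so the weight crossing
    -- the cut, times a_k b_{k+1}, is at most K.
    set J : Finset (Fin (n + 1)) := Finset.Iic k.castSucc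
    have hJ : J.Nonempty := ⟨k.castSucc, by simp [J]⟩
    have hJ' : J ≠ Finset.univ := fun hh => by
      have : k.succ ∈ J := hh ▸ Finset.mem_univ _
      simp [J, Fin.le_def] at this
    have hpos : 0 ≤ a k.castSucc * b k.succ := mul_nonneg (ha0 _) (hb0 _)
    have hnn : ∀ i j, 0 ≤ b i * a j * transportWeight E U W i j := fun i j =>
      mul_nonneg (mul_nonneg (hb0 i) (ha0 j)) (hE.transportWeight_nonneg U W i j)
    have hsum : (a k.castSucc * b k.succ) * ∑ i ∈ Jᶜ, ∑ j ∈ J, transportWeight E U W i j ≤ K := by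
      refine le_trans ?_ hK
      rw [Finset.mul_sum]
      refine le_trans (Finset.sum_le_sum fun i hi => ?_) (Finset.sum_le_sum_of_subset_of_nonneg
        (Finset.subset_univ Jᶜ) fun i _ _ => Finset.sum_nonneg fun j _ => hnn i j)
      rw [Finset.mul_sum]
      refine le_trans (Finset.sum_le_sum fun j hj => ?_) (Finset.sum_le_sum_of_subset_of_nonneg
        (Finset.subset_univ J) fun j _ _ => hnn i j)
      have hi' : k.succ ≤ i := by
        rw [Finset.mem_compl, Finset.mem_Iic, not_le] at hi
        exact hi
      have hj' : j ≤ k.castSucc := Finset.mem_Iic.mp hj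
      refine mul_le_mul_of_nonneg_right ?_ (hE.transportWeight_nonneg U W i j)
      rw [mul_comm]
      exact mul_le_mul (hb hi') (ha hj') (ha0 _) (hb0 _)
    calc a k.castSucc * b k.succ ≤ (a k.castSucc * b k.succ) *
          (C * ∑ i ∈ Jᶜ, ∑ j ∈ J, transportWeight E U W i j) :=
          le_mul_of_one_le_right hpos (hC U hU W hW J hJ hJ')
      _ = C * ((a k.castSucc * b k.succ) * ∑ i ∈ Jᶜ, ∑ j ∈ J, transportWeight E U W i j) := by ring
      _ ≤ C * K := mul_le_mul_of_nonneg_left hsum hC0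
  have hb := le_pow_of_prod_eq_one ha0 hb0 ha hb (by exact_mod_cast hA1) (by exact_mod_cast hB1)
    (le_max_left _ _) hk
  exact ⟨norm_unitaryDiag_apply_le hU ha0 hb.1, norm_unitaryDiag_apply_le hW hb0 hb.2⟩

theorem isClosed_posSemidef (d : ℕ) : IsClosed {A : MatC d | A.PosSemidef} := by
  have e : {A : MatC d | A.PosSemidef} = {A : MatC d | Aᴴ = A} ∩
      ⋂ x : Fin d → ℂ, {A : MatC d | 0 ≤ star x ⬝ᵥ (A *ᵥ x)} := by
    refine Set.ext fun A => ?_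
    simp only [Set.mem_ofPred_eq, Set.mem_inter_iff, Set.mem_iInter]
    rw [Matrix.posSemidef_iff_dotProduct_mulVec]
    rfl
  rw [e]
  refine (isClosed_eq continuous_id.matrix_conjTranspose continuous_id).inter
    (isClosed_iInter fun x => ?_)
  have hc : Continuous fun A : MatC d => star x ⬝ᵥ (A *ᵥ x) :=
    continuous_const.dotProduct (continuous_id.matrix_mulVec continuous_const)
  exact isClosed_Ici.preimage hc

/-- The capacity of a fully indecomposable map is attained. -/
theorem IsFullyIndecomposable.exists_isMin {n : ℕ} {E : MatC (n + 1) →ₗ[ℂ] MatC (n + 1)}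
    (hE : IsPositiveMap E) (h : IsFullyIndecomposable E) :
    ∃ A B : MatC (n + 1), A.PosSemidef ∧ B.PosSemidef ∧ A.det = 1 ∧ B.det = 1 ∧
      ∀ A' B' : MatC (n + 1), A'.PosSemidef → B'.PosSemidef → A'.det = 1 → B'.det = 1 →
        (B * E A).trace.re ≤ (B' * E A').trace.re := by
  set f : MatC (n + 1) × MatC (n + 1) → ℝ := fun p => (p.2 * E p.1).trace.re with hf
  have hfc : Continuous f := by
    have hEc : Continuous E := E.continuous_of_finiteDimensional
    exact Complex.continuous_re.comp (continuous_snd.mul (hEc.comp continuous_fst)).matrix_trace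
  set T : Set (MatC (n + 1)) := {A | A.PosSemidef} ∩ {A | A.det = 1} with hT
  have hTc : IsClosed T :=
    (isClosed_posSemidef _).inter (isClosed_eq continuous_id.matrix_det continuous_const)
  obtain ⟨R, hR⟩ := h.exists_entry_bound hE (f (1, 1))
  -- Only the sublevel set through (1, 1) matters: outside it the value exceeds that at (1, 1),
  -- hence the minimum on S.
  set S : Set (MatC (n + 1) × MatC (n + 1)) := (T ×ˢ T) ∩ {p | f p ≤ f (1, 1)} with hS
  have hSc : IsCompact S := by
    refine ((isCompact_entrywise_closedBall _ R).prod
      (isCompact_entrywise_closedBall _ R)).of_isClosed_subset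
      ((hTc.prod hTc).inter (isClosed_le hfc continuous_const)) ?_
    rintro ⟨A, B⟩ ⟨⟨hA, hB⟩, hK⟩
    exact hR A B hA.1 hB.1 hA.2 hB.2 hK
  have h1 : (1 : MatC (n + 1)) ∈ T := ⟨.one, Matrix.det_one⟩
  obtain ⟨⟨A, B⟩, ⟨⟨hA, hB⟩, hK⟩, hmin⟩ :=
    hSc.exists_isMinOn ⟨(1, 1), ⟨h1, h1⟩, le_refl (f (1, 1))⟩ hfc.continuousOn
  refine ⟨A, B, hA.1, hB.1, hA.2, hB.2, fun A' B' hA' hB' hA1 hB1 => ?_⟩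
  by_cases hle : f (A', B') ≤ f (1, 1)
  · exact hmin (show (A', B') ∈ S from ⟨⟨⟨hA', hA1⟩, ⟨hB', hB1⟩⟩, hle⟩)
  · exact le_trans hK (not_le.mp hle).le

/-! ### Scalability of fully indecomposable maps -/

/-- Equality in the trace form of the arithmetic-geometric mean inequality. -/
theorem Matrix.PosSemidef.eq_smul_one_of_trace_le {d : ℕ} {G : MatC d} (hG : G.PosSemidef)
    (h : ∀ A : MatC d, A.PosSemidef → A.det = 1 → G.trace.re ≤ (G * A).trace.re) :
    ∃ g : ℝ, 0 ≤ g ∧ G = (g : ℂ) • 1 := by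
  obtain ⟨U, hU, a, rfl⟩ := hG.isHermitian.exists_unitaryDiag
  have ha0 := nonneg_of_posSemidef_unitaryDiag hU hG
  have hle : ∀ i j, a i ≤ a j := by
    intro i j
    by_cases hij : i = j
    · rw [hij]
    have key : ∀ t : ℝ, 1 < t → a i ≤ t * a j := by
      intro t ht
      have ht0 : 0 < t := zero_lt_one.trans ht
      -- The test matrix has eigenvalue t⁻¹ at i, t at j and 1 elsewhere. Removing the positive
      -- factor (t - 1)/t from the resulting inequality leaves a_i ≤ t a_j.
      set α : Fin d → ℝ := Pi.mulSingle i t⁻¹ * Pi.mulSingle j t with hα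
      have hα0 : ∀ k, 0 ≤ α k := by
        intro k
        simp only [hα, Pi.mul_apply, Pi.mulSingle_apply]
        split_ifs <;> positivity
      have hαp : ∏ k, α k = 1 := by
        simp only [hα, Pi.mul_apply, Finset.prod_mul_distrib, Pi.mulSingle_apply,
          Finset.prod_ite_eq']
        simp [ht0.ne']
      have h1 := h (unitaryDiag U α) (posSemidef_unitaryDiag U hα0) (by
        rw [det_unitaryDiag hU, hαp, Complex.ofReal_one])
      rw [unitaryDiag_mul hU, trace_unitaryDiag hU, trace_unitaryDiag hU, ← Complex.ofReal_sum,
        ← Complex.ofReal_sum, Complex.ofReal_re, Complex.ofReal_re, ← sub_nonneg,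
        ← Finset.sum_sub_distrib] at h1
      have h2 : ∑ k, ((a * α) k - a k) = a i * (t⁻¹ - 1) + a j * (t - 1) := by
        have : ∀ k, (a * α) k - a k = (if k = i then a i * (t⁻¹ - 1) else 0) +
            (if k = j then a j * (t - 1) else 0) := by
          intro k
          simp only [hα, Pi.mul_apply, Pi.mulSingle_apply]
          by_cases hki : k = i
          · subst hki; simp [hij]; ring
          · by_cases hkj : k = j
            · subst hkj; simp [hki]; ring
            · simp [hki, hkj]
        simp only [this, Finset.sum_add_distrib, Finset.sum_ite_eq', Finset.mem_univ, if_true]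
      rw [h2] at h1
      have h3 : a i * (t⁻¹ - 1) + a j * (t - 1) = (t - 1) / t * (t * a j - a i) := by
        field_simp; ring
      rw [h3] at h1
      have h4 : 0 < (t - 1) / t := div_pos (sub_pos.mpr ht) ht0
      exact sub_nonneg.mp ((mul_nonneg_iff_of_pos_left h4).mp h1)
    -- If a_j > 0, some t strictly between 1 and a_i/a_j gives a contradiction; if a_j = 0, any t >
    -- 1 does.
    by_contra! hlt
    rcases (ha0 j).eq_or_lt with hj | hj
    · have := key 2 one_lt_two
      rw [← hj, mul_zero] at this
      exact absurd hlt (by rw [← hj]; exact this.not_gt)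
    · obtain ⟨t, ht1, ht2⟩ := exists_between ((one_lt_div hj).mpr hlt)
      exact absurd ((lt_div_iff₀ hj).mp ht2) (key t ht1).not_gt
  rcases isEmpty_or_nonempty (Fin d) with he | ⟨⟨i⟩⟩
  · exact ⟨0, le_rfl, Matrix.ext fun i => he.elim i⟩
  · refine ⟨a i, ha0 i, ?_⟩
    rw [← unitaryDiag_const hU]
    congr 1
    ext j
    exact le_antisymm (hle j i) (hle i j)

/-- Conjugation by the factors of the minimiser moves it to (1, 1), where minimality in each
variable separately makes F(1) and F*(1) scalar. -/
theorem IsFullyIndecomposable.isScalable {d : ℕ} {E : MatC d →ₗ[ℂ] MatC d}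
    (hE : IsPositiveMap E) (h : IsFullyIndecomposable E) : IsScalable E := by
  rcases d with _ | n
  · exact ⟨1, 1, Matrix.ext fun i => i.elim0, Matrix.ext fun i => i.elim0⟩
  obtain ⟨A, B, hA, hB, hA1, hB1, hmin⟩ := h.exists_isMin hE
  obtain ⟨X₀, hX⟩ := hA.exists_eq_conjTranspose_mul
  obtain ⟨Y₀, hY⟩ := hB.exists_eq_conjTranspose_mul
  obtain ⟨X, rfl⟩ : ∃ X, X₀ = Xᴴ := ⟨X₀ᴴ, (Matrix.conjTranspose_conjTranspose _).symm⟩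
  obtain ⟨Y, rfl⟩ : ∃ Y, Y₀ = Yᴴ := ⟨Y₀ᴴ, (Matrix.conjTranspose_conjTranspose _).symm⟩
  rw [Matrix.conjTranspose_conjTranspose] at hX hY
  rw [hX, Matrix.det_mul] at hA1
  rw [hY, Matrix.det_mul] at hB1
  have hXu : IsUnit X := (Matrix.isUnit_iff_isUnit_det _).mpr (IsUnit.of_mul_eq_one _ hA1)
  have hYu : IsUnit Y := (Matrix.isUnit_iff_isUnit_det _).mpr (IsUnit.of_mul_eq_one _ hB1)
  set F := _root_.scaledMap E X Y with hFdef
  have hF : IsPositiveMap F := hE.scaledMap X Y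
  have hFI : IsFullyIndecomposable F := h.scaledMap hXu hYu
  have htr : ∀ A' B' : MatC (n + 1),
      (B' * F A').trace = ((Y * B' * Yᴴ) * E (X * A' * Xᴴ)).trace := by
    intro A' B'
    rw [hFdef, scaledMap_apply, ← mul_assoc, Matrix.trace_mul_comm]
    simp only [mul_assoc]
  have hF1 : (F 1).trace = (B * E A).trace := by
    have := htr 1 1
    rwa [one_mul, mul_one, mul_one, ← hX, ← hY] at this
  obtain ⟨g, hg0, hg⟩ := (hF 1 .one).eq_smul_one_of_trace_le fun B' hB' hB'1 => by
    rw [hF1, Matrix.trace_mul_comm (F 1), htr, mul_one, ← hX]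
    refine hmin _ _ hA (hB'.mul_mul_conjTranspose_same Y) (by rw [hX, Matrix.det_mul, hA1]) ?_
    rw [Matrix.det_mul, Matrix.det_mul, hB'1, mul_one, hB1]
  have hadj : ∀ A' : MatC (n + 1), (hsAdjoint F 1 * A').trace = (F A').trace := fun A' => by
    rw [hF.trace_hsAdjoint_mul Matrix.isHermitian_one, one_mul]
  obtain ⟨g', hg'0, hg'⟩ := (hF.hsAdjoint 1 .one).eq_smul_one_of_trace_le fun A' hA' hA'1 => by
    have e1 : (hsAdjoint F 1).trace = (F 1).trace := by rw [← hadj, mul_one]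
    have e2 := htr A' 1
    rw [one_mul, mul_one, ← hY] at e2
    rw [e1, hF1, hadj, e2]
    refine hmin _ _ (hA'.mul_mul_conjTranspose_same X) hB ?_ (by rw [hY, Matrix.det_mul, hB1])
    rw [Matrix.det_mul, Matrix.det_mul, hA'1, mul_one, hA1]
  -- F(1) and F*(1) have the same trace.
  have hgg : g' = g := by
    have e1 : (hsAdjoint F 1).trace = (F 1).trace := by rw [← hadj, mul_one]
    rw [hg, hg', Matrix.trace_smul, Matrix.trace_smul, Matrix.trace_one, smul_eq_mul,
      smul_eq_mul, Fintype.card_fin] at e1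
    exact_mod_cast mul_right_cancel₀ (Nat.cast_ne_zero.mpr (Nat.succ_ne_zero n)) e1
  have hgpos : 0 < g := by
    refine lt_of_le_of_ne hg0 fun h0 => hFI.1 (hF.eq_zero_of_map_one ?_)
    rw [hg, ← h0, Complex.ofReal_zero, zero_smul]
  -- Only X is rescaled; it enters quadratically, whence the square root.
  set s : ℝ := (Real.sqrt g)⁻¹ with hs
  have hsg : s * s * g = 1 := by
    rw [hs, ← mul_inv, Real.mul_self_sqrt hg0, inv_mul_cancel₀ hgpos.ne']
  refine ⟨X * ((s : ℂ) • 1), Y * 1, ?_⟩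
  rw [IsScaling, ← scaledMap_scaledMap, ← hFdef]
  change IsScaling F _ _
  rw [isScaling_iff]
  have hsg' : s * (g * s) = 1 := by rw [mul_comm g, ← mul_assoc, hsg]
  simp [hg, hg', hgg, smul_smul, hsg, hsg']

/-! ### Uniqueness of scalings -/

/-- A fully indecomposable doubly stochastic array of weights has only trivial scalings. -/
theorem exists_const_of_scaled_weights {ι : Type*} [Fintype ι] [DecidableEq ι] [Nonempty ι]
    {D : ι → ι → ℝ} {a b : ι → ℝ} (hD : ∀ i j, 0 ≤ D i j) (hrow : ∀ i, ∑ j, D i j = 1)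
    (hcol : ∀ j, ∑ i, D i j = 1) (hb0 : ∀ i, 0 ≤ b i)
    (hb : ∀ i, b i * ∑ j, a j * D i j = 1) (ha : ∀ j, a j * ∑ i, b i * D i j = 1)
    (hind : ∀ J I : Finset ι, J.Nonempty → J.card = I.card → (∀ j ∈ J, ∀ i ∉ I, D i j = 0) →
      J = Finset.univ ∧ I = Finset.univ) :
    ∃ m : ℝ, 0 < m ∧ (∀ j, a j = m) ∧ ∀ i, b i = m⁻¹ := by
  obtain ⟨j₀, hj₀⟩ := Finite.exists_max a
  set m := a j₀ with hm
  have hm0 : 0 < m := by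
    have h0 : 0 ≤ ∑ i, b i * D i j₀ :=
      Finset.sum_nonneg fun i _ => mul_nonneg (hb0 i) (hD i j₀)
    by_contra! hle
    have := mul_nonpos_of_nonpos_of_nonneg hle h0
    rw [hm, ha j₀] at this
    exact absurd this one_pos.not_ge
  -- Row averages of a are at most its maximum m, so b_i ≥ 1/m. The extremal sets J, where a_j = m,
  -- and I, where b_i = 1/m, are then compared.
  have hbm : ∀ i, 0 ≤ m * b i - 1 := by
    intro i
    have h1 : ∑ j, a j * D i j ≤ m := by
      calc ∑ j, a j * D i j ≤ ∑ j, m * D i j :=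
            Finset.sum_le_sum fun j _ => mul_le_mul_of_nonneg_right (hj₀ j) (hD i j)
        _ = m := by rw [← Finset.mul_sum, hrow, mul_one]
    have h2 := mul_le_mul_of_nonneg_left h1 (hb0 i)
    rw [hb i] at h2
    linarith
  set J := Finset.univ.filter fun j => a j = m with hJ
  set I := Finset.univ.filter fun i => m * b i = 1 with hI
  have h1 : ∀ j ∈ J, ∀ i ∉ I, D i j = 0 := by
    intro j hj i hi
    have hj' : a j = m := by simpa [hJ] using hj
    have hi' : m * b i ≠ 1 := by simpa [hI] using hi
    -- A sum of nonnegative terms vanishes, so column j has no weight outside I; rows in I are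
    -- treated in the same way.
    have hsum : ∑ i, (m * b i - 1) * D i j = 0 := by
      simp only [sub_mul, one_mul, Finset.sum_sub_distrib, mul_assoc, ← Finset.mul_sum, hcol]
      rw [← hj', ha j, sub_self]
    have h := (Finset.sum_eq_zero_iff_of_nonneg
      fun i _ => mul_nonneg (hbm i) (hD i j)).mp hsum i (Finset.mem_univ i)
    exact (mul_eq_zero.mp h).resolve_left (sub_ne_zero.mpr hi')
  have h2 : ∀ i ∈ I, ∀ j ∉ J, D i j = 0 := by
    intro i hi j hj
    have hj' : a j ≠ m := by simpa [hJ] using hj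
    have hi' : m * b i = 1 := by simpa [hI] using hi
    have hsum : ∑ j, (m - a j) * D i j = 0 := by
      simp only [sub_mul, Finset.sum_sub_distrib, ← Finset.mul_sum, hrow]
      have h3 : m * (b i * ∑ j, a j * D i j) = m := by rw [hb i, mul_one]
      rw [← mul_assoc, hi', one_mul] at h3
      rw [h3, mul_one, sub_self]
    have h := (Finset.sum_eq_zero_iff_of_nonneg
      fun j _ => mul_nonneg (sub_nonneg.mpr (hj₀ j)) (hD i j)).mp hsum j (Finset.mem_univ j)
    exact (mul_eq_zero.mp h).resolve_left (sub_ne_zero.mpr hj'.symm)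
  -- The block I × J contains all the mass of its rows and of its columns, so it is doubly
  -- stochastic and hence square.
  have hcard : J.card = I.card := by
    have e1 : (J.card : ℝ) = ∑ j ∈ J, ∑ i ∈ I, D i j := by
      rw [Finset.card_eq_sum_ones, Nat.cast_sum]
      refine Finset.sum_congr rfl fun j hj => ?_
      rw [Nat.cast_one, ← hcol j]
      exact (Finset.sum_subset (Finset.subset_univ I) fun i _ hi => h1 j hj i hi).symm
    have e2 : (I.card : ℝ) = ∑ i ∈ I, ∑ j ∈ J, D i j := by
      rw [Finset.card_eq_sum_ones, Nat.cast_sum]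
      refine Finset.sum_congr rfl fun i hi => ?_
      rw [Nat.cast_one, ← hrow i]
      exact (Finset.sum_subset (Finset.subset_univ J) fun j _ hj => h2 i hi j hj).symm
    rw [Finset.sum_comm] at e2
    exact_mod_cast e1.trans e2.symm
  obtain ⟨hJu, hIu⟩ := hind J I ⟨j₀, by simp [hJ, hm]⟩ hcard h1
  refine ⟨m, hm0, fun j => ?_, fun i => ?_⟩
  · have : j ∈ J := hJu ▸ Finset.mem_univ j
    simpa [hJ] using this
  · have : i ∈ I := hIu ▸ Finset.mem_univ i
    exact (inv_eq_of_mul_eq_one_right (by simpa [hI] using this)).symm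

section Uniqueness

variable {d : ℕ} {E : MatC d →ₗ[ℂ] MatC d}

/-- The adjoint has the transposed weights, so the column conditions can be read off from E*. -/
theorem IsPositiveMap.transportWeight_hsAdjoint (hE : IsPositiveMap E) (U W : MatC d)
    (i j : Fin d) : transportWeight (_root_.hsAdjoint E) W U j i = transportWeight E U W i j := by
  have key : ∀ (V M : MatC d) (k : Fin d),
      (unitaryDiag V (Pi.single k 1) * M).trace = (Vᴴ * M * V) k k := by
    intro V M k
    rw [trace_unitaryDiag_mul, Finset.sum_eq_single k]
    · simp
    · intro l _ hl
      simp [hl]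
    · simp
  have hW : (unitaryDiag W (Pi.single i 1)).IsHermitian :=
    (posSemidef_unitaryDiag W fun k => by rw [Pi.single_apply]; split_ifs <;> simp).isHermitian
  rw [transportWeight, transportWeight, ← key, ← key, Matrix.trace_mul_comm,
    hE.trace_hsAdjoint_mul hW]

theorem smul_unitary_of_mul_conjTranspose {m : ℝ} (hm : 0 < m) {Z : MatC d}
    (hZ : Z * Zᴴ = (m : ℂ) • 1) :
    ∃ U ∈ Matrix.unitaryGroup (Fin d) ℂ, Z = (Real.sqrt m : ℂ) • U := by
  have hs : ((Real.sqrt m : ℝ) : ℂ) ≠ 0 := by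
    exact_mod_cast (Real.sqrt_pos.mpr hm).ne'
  refine ⟨(Real.sqrt m : ℂ)⁻¹ • Z, ?_, ?_⟩
  · rw [Matrix.mem_unitaryGroup_iff]
    change _ * (_ • Z)ᴴ = 1
    rw [Matrix.conjTranspose_smul, Matrix.smul_mul, Matrix.mul_smul, hZ, smul_smul, smul_smul,
      star_inv₀, Complex.star_def, Complex.conj_ofReal, ← mul_inv, ← Complex.ofReal_mul,
      Real.mul_self_sqrt hm.le, inv_mul_cancel₀ (by exact_mod_cast hm.ne'), one_smul]
  · rw [smul_smul, mul_inv_cancel₀ hs, one_smul]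

/-- In eigenbases of ZZ† and WW†, the diagonals of the scaling equations say that the eigenvalues
rescale a doubly stochastic array of weights to another one; such a rescaling is constant. -/
theorem IsFullyIndecomposable.scaling_of_doublyStochastic [NeZero d] (hE : IsPositiveMap E)
    (h : IsFullyIndecomposable E) (hds : IsDoublyStochasticMap E) {Z W : MatC d}
    (hs : IsScaling E Z W) :
    ∃ m : ℝ, 0 < m ∧ Z * Zᴴ = (m : ℂ) • 1 ∧ W * Wᴴ = ((m⁻¹ : ℝ) : ℂ) • 1 := by
  rw [isScaling_iff] at hs
  obtain ⟨U, hU, a, hA⟩ := (Matrix.isHermitian_mul_conjTranspose_self Z).exists_unitaryDiag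
  obtain ⟨V, hV, b, hB⟩ := (Matrix.isHermitian_mul_conjTranspose_self W).exists_unitaryDiag
  have hb0 := nonneg_of_posSemidef_unitaryDiag hV
    (hB ▸ Matrix.posSemidef_self_mul_conjTranspose W)
  -- A one-sided inverse is two-sided, so the right factor W can be moved to the left, producing
  -- WW†.
  have h1 : unitaryDiag V b * E (unitaryDiag U a) = 1 := by
    rw [← hA, ← hB, mul_assoc]
    exact mul_eq_one_comm.mp hs.1
  have h2 : unitaryDiag U a * hsAdjoint E (unitaryDiag V b) = 1 := by
    rw [← hA, ← hB, mul_assoc]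
    exact mul_eq_one_comm.mp hs.2
  have hdiag : ∀ {V M : MatC d} {b : Fin d → ℝ}, V ∈ Matrix.unitaryGroup (Fin d) ℂ →
      unitaryDiag V b * M = 1 → ∀ i, (b i : ℂ) * (Vᴴ * M * V) i i = 1 := by
    intro V M b hV h i
    have e : Matrix.diagonal (fun i => (b i : ℂ)) * (Vᴴ * M * V) = 1 := by
      calc _ = (Vᴴ * V) * Matrix.diagonal (fun i => (b i : ℂ)) * (Vᴴ * M * V) := by
            rw [Matrix.mem_unitaryGroup_left hV, one_mul]
        _ = Vᴴ * (unitaryDiag V b * M) * V := by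
            simp only [unitaryDiag, mul_assoc]
        _ = 1 := by rw [h, mul_one, Matrix.mem_unitaryGroup_left hV]
    have := congrFun (congrFun e i) i
    rwa [Matrix.diagonal_mul, Matrix.one_apply_eq] at this
  have hD := hE.transportWeight_nonneg U V
  have hrow : ∀ i, ∑ j, transportWeight E U V i j = 1 := by
    intro i
    have := hE.diag_map_unitaryDiag U V 1 i
    rw [unitaryDiag_one hU, hds.1, mul_one, Matrix.mem_unitaryGroup_left hV,
      Matrix.one_apply_eq] at this
    simp only [Pi.one_apply, one_mul] at this
    exact_mod_cast this.symm
  have hcol : ∀ j, ∑ i, transportWeight E U V i j = 1 := by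
    intro j
    have := hE.hsAdjoint.diag_map_unitaryDiag V U 1 j
    rw [unitaryDiag_one hV, hds.2, mul_one, Matrix.mem_unitaryGroup_left hU,
      Matrix.one_apply_eq] at this
    simp only [Pi.one_apply, one_mul, hE.transportWeight_hsAdjoint] at this
    exact_mod_cast this.symm
  have hb : ∀ i, b i * ∑ j, a j * transportWeight E U V i j = 1 := by
    intro i
    have := hdiag hV h1 i
    rw [hE.diag_map_unitaryDiag] at this
    exact_mod_cast this
  have ha : ∀ j, a j * ∑ i, b i * transportWeight E U V i j = 1 := by
    intro j
    have := hdiag hU h2 j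
    rw [hE.hsAdjoint.diag_map_unitaryDiag] at this
    simp only [hE.transportWeight_hsAdjoint] at this
    exact_mod_cast this
  obtain ⟨m, hm, ham, hbm⟩ := exists_const_of_scaled_weights hD hrow hcol hb0 hb ha
    fun J I hJ hIJ h0 => h.eq_univ_of_transportWeight hE hU hV hJ hIJ h0
  refine ⟨m, hm, ?_, ?_⟩
  · rw [hA, ← unitaryDiag_const hU, funext ham]
  · rw [hB, ← unitaryDiag_const hV, funext hbm]

/-- Relative to the first scaling the second one scales a doubly stochastic map, so the relative
matrices are reciprocal multiples of unitaries. -/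
theorem IsFullyIndecomposable.isUniquelyScalable [NeZero d] (hE : IsPositiveMap E)
    (h : IsFullyIndecomposable E) : IsUniquelyScalable E := by
  refine ⟨h.isScalable hE, fun X₁ Y₁ X₂ Y₂ h₁ h₂ => ?_⟩
  obtain ⟨X', hX'⟩ := h₁.isUnit_left.exists_right_inv
  obtain ⟨Y', hY'⟩ := h₁.isUnit_right.exists_right_inv
  have eX : X₁ * (X' * X₂) = X₂ := by rw [← mul_assoc, hX', one_mul]
  have eY : Y₁ * (Y' * Y₂) = Y₂ := by rw [← mul_assoc, hY', one_mul]
  have hs : IsScaling (_root_.scaledMap E X₁ Y₁) (X' * X₂) (Y' * Y₂) := by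
    rw [IsScaling, scaledMap_scaledMap, eX, eY]
    exact h₂
  obtain ⟨m, hm, hZ, hW⟩ := (h.scaledMap h₁.isUnit_left h₁.isUnit_right).scaling_of_doublyStochastic
    (hE.scaledMap X₁ Y₁) h₁ hs
  obtain ⟨U, hU, hU'⟩ := smul_unitary_of_mul_conjTranspose hm hZ
  obtain ⟨V, hV, hV'⟩ := smul_unitary_of_mul_conjTranspose (inv_pos.mpr hm) hW
  refine ⟨Real.sqrt m, Real.sqrt_pos.mpr hm, U, hU, V, hV, ?_, ?_⟩
  · rw [← Matrix.mul_smul, ← hU', eX]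
  · rw [← Matrix.mul_smul, ← Complex.ofReal_inv, ← Real.sqrt_inv, ← hV', eY]

/-- A doubly stochastic map that sends a nontrivial corner to one of the same size has a nontrivial
family of scalings. -/
theorem IsDoublyStochasticMap.isScaling_of_map_eq (hds : IsDoublyStochasticMap E)
    (hE : IsPositiveMap E) {P Q : MatC d} (hP : IsStarProjection P) (hQ : IsStarProjection Q)
    (h : E P = Q) : IsScaling E (1 + P) (1 - (2⁻¹ : ℂ) • Q) := by
  have h' := hds.hsAdjoint_eq_of_map_eq hE hP hQ h
  have eX : (1 + P)ᴴ = 1 + P := by rw [Matrix.conjTranspose_add, hP.conjTranspose_eq]; simp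
  have eY : (1 - (2⁻¹ : ℂ) • Q)ᴴ = 1 - (2⁻¹ : ℂ) • Q := by
    rw [Matrix.conjTranspose_sub, Matrix.conjTranspose_smul, hQ.conjTranspose_eq]; simp
  have eXX : (1 + P) * (1 + P) = 1 + (3 : ℂ) • P := by
    rw [add_mul, mul_add, mul_add, hP.mul_self, one_mul, mul_one, one_mul]
    module
  have eYY : (1 - (2⁻¹ : ℂ) • Q) * (1 - (2⁻¹ : ℂ) • Q) = 1 - (3 / 4 : ℂ) • Q := by
    simp only [sub_mul, mul_sub, Matrix.smul_mul, Matrix.mul_smul, hQ.mul_self, one_mul, mul_one]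
    module
  rw [isScaling_iff, eX, eY, eXX, eYY, map_add, map_sub, map_smul, map_smul, hds.1, hds.2, h, h']
  constructor
  · simp only [sub_mul, mul_sub, mul_add, add_mul, Matrix.smul_mul, Matrix.mul_smul, one_mul,
      mul_one, hQ.mul_self]
    module
  · simp only [sub_mul, mul_sub, mul_add, add_mul, Matrix.smul_mul, Matrix.mul_smul, one_mul,
      mul_one, hP.mul_self]
    module

/-- The doubly stochastic scaled map is tested with the family stretched along P; the conclusion
returns to `E` through the inverse scaling. -/
theorem IsUniquelyScalable.isFullyIndecomposable [NeZero d] (hE : IsPositiveMap E)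
    (h : IsUniquelyScalable E) : IsFullyIndecomposable E := by
  obtain ⟨⟨X, Y, hs⟩, huniq⟩ := h
  obtain ⟨X', hX1, hX2⟩ := isUnit_iff_exists.mp hs.isUnit_left
  obtain ⟨Y', hY1, hY2⟩ := isUnit_iff_exists.mp hs.isUnit_right
  have hF := hE.scaledMap X Y
  have hFI : IsFullyIndecomposable (scaledMap E X Y) := by
    refine ⟨fun h0 => ?_, fun P Q hP hQ hP0 hQ0 hr hm => ?_⟩
    · have := hs.1
      rw [h0, LinearMap.zero_apply] at this
      exact zero_ne_one this
    · have hPQ := hs.map_eq_of_mapsTo hF hP hQ hr hm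
      have h2 := hs.isScaling_of_map_eq hF hP hQ hPQ
      rw [IsScaling, scaledMap_scaledMap] at h2
      obtain ⟨c, hc, U, hU, -, -, hXU, -⟩ := huniq _ _ _ _ hs h2
      have h3 : 1 + P = (c : ℂ) • U := by
        have := congrArg (X' * ·) hXU
        rwa [Matrix.mul_smul, ← mul_assoc, ← mul_assoc, hX2, one_mul, one_mul] at this
      -- Since 1 + P is c times a unitary, its square 1 + 3P is the scalar c². On the range of P
      -- this scalar is 4, whence P = 1.
      have h4 : 1 + (3 : ℂ) • P = ((c * c : ℝ) : ℂ) • 1 := by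
        have e : (1 + P) * (1 + P)ᴴ = ((c * c : ℝ) : ℂ) • 1 := by
          rw [h3, Matrix.conjTranspose_smul, Matrix.smul_mul, Matrix.mul_smul,
            Matrix.mem_unitaryGroup_right hU, smul_smul, Complex.star_def, Complex.conj_ofReal,
            Complex.ofReal_mul]
        rw [← e, Matrix.conjTranspose_add, hP.conjTranspose_eq, Matrix.conjTranspose_one, add_mul,
          mul_add, mul_add, hP.mul_self, one_mul, mul_one, one_mul]
        module
      have h5 : (((c * c : ℝ) : ℂ) - 4) • P = 0 := by
        have := congrArg (· * P) h4
        rw [add_mul, one_mul, Matrix.smul_mul, hP.mul_self, Matrix.smul_mul, one_mul] at this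
        rw [sub_smul, ← this]
        module
      have h6 : ((c * c : ℝ) : ℂ) = 4 :=
        sub_eq_zero.mp ((smul_eq_zero.mp h5).resolve_right hP0)
      rw [h6] at h4
      have h7 : P = 1 := by
        have e : (3 : ℂ) • P = (3 : ℂ) • 1 := by
          rw [eq_sub_of_add_eq' h4]
          module
        exact smul_right_injective _ (by norm_num : (3 : ℂ) ≠ 0) e
      refine ⟨h7, ?_⟩
      rw [← hPQ, h7, hs.1]
  have := hFI.scaledMap (X := X') (Y := Y') (isUnit_iff_exists.mpr ⟨X, hX2, hX1⟩)
    (isUnit_iff_exists.mpr ⟨Y, hY2, hY1⟩)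
  rwa [scaledMap_scaledMap, hX1, hY1, scaledMap_one_one] at this

end Uniqueness

/-! ### Restriction to a corner -/

section Compression

variable {d r : ℕ}

/-- The compression `A ↦ V† E(V A V†) V` of a map along an isometry `V`. -/
def compressedMap (E : MatC d →ₗ[ℂ] MatC d) (V : Matrix (Fin d) (Fin r) ℂ) :
    MatC r →ₗ[ℂ] MatC r where
  toFun A := Vᴴ * E (V * A * Vᴴ) * V
  map_add' A B := by simp [Matrix.mul_add, Matrix.add_mul]
  map_smul' c A := by simp

theorem compressedMap_apply (E : MatC d →ₗ[ℂ] MatC d) (V : Matrix (Fin d) (Fin r) ℂ) (A : MatC r) :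
    compressedMap E V A = Vᴴ * E (V * A * Vᴴ) * V := rfl

theorem IsPositiveMap.compressedMap {E : MatC d →ₗ[ℂ] MatC d} (hE : IsPositiveMap E)
    (V : Matrix (Fin d) (Fin r) ℂ) : IsPositiveMap (compressedMap E V) := fun _ hA =>
  (hE _ (hA.mul_mul_conjTranspose_same V)).conjTranspose_mul_mul_same V

variable {E : MatC d →ₗ[ℂ] MatC d} {V : Matrix (Fin d) (Fin r) ℂ} {P : MatC d}

theorem conj_isometry_mul (hV : Vᴴ * V = 1) (A B : MatC r) :
    (V * A * Vᴴ) * (V * B * Vᴴ) = V * (A * B) * Vᴴ := by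
  calc _ = V * A * (Vᴴ * V) * B * Vᴴ := by simp only [Matrix.mul_assoc]
    _ = _ := by rw [hV, Matrix.mul_one]; simp only [Matrix.mul_assoc]

theorem compress_conj_isometry (hV : Vᴴ * V = 1) (A : MatC r) : Vᴴ * (V * A * Vᴴ) * V = A := by
  calc _ = (Vᴴ * V) * A * (Vᴴ * V) := by simp only [Matrix.mul_assoc]
    _ = _ := by rw [hV, Matrix.mul_one, Matrix.one_mul]

theorem conj_compress_isometry (hVP : V * Vᴴ = P) (A : MatC d) :
    V * (Vᴴ * A * V) * Vᴴ = P * A * P := by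
  rw [← hVP]; simp only [Matrix.mul_assoc]

theorem conj_isometry_mem_corner (hV : Vᴴ * V = 1) (hVP : V * Vᴴ = P) (A : MatC r) :
    V * A * Vᴴ ∈ corner P :=
  ⟨V * A * Vᴴ, by
    dsimp only
    rw [← conj_compress_isometry hVP, compress_conj_isometry hV]⟩

theorem isStarProjection_conj_isometry (hV : Vᴴ * V = 1) {Q : MatC r} (hQ : IsStarProjection Q) :
    IsStarProjection (V * Q * Vᴴ) := by
  refine ⟨?_, ?_⟩
  · change _ * _ = _
    rw [conj_isometry_mul hV, hQ.mul_self]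
  · change _ᴴ = _
    rw [Matrix.conjTranspose_mul, Matrix.conjTranspose_mul, Matrix.conjTranspose_conjTranspose,
      hQ.conjTranspose_eq, Matrix.mul_assoc]

theorem trace_conj_isometry (hV : Vᴴ * V = 1) (Q : MatC r) : (V * Q * Vᴴ).trace = Q.trace := by
  rw [Matrix.trace_mul_comm, ← Matrix.mul_assoc, hV, Matrix.one_mul]

/-- The isometry identifies the corner with a full matrix algebra, preserving projections and their
traces, so results about full algebras apply to a single block. -/
theorem IsFullyIndecomposableOn.compressedMap (hP : IsStarProjection P) (hV : Vᴴ * V = 1)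
    (hVP : V * Vᴴ = P) (h : IsFullyIndecomposableOn E P) :
    IsFullyIndecomposable (compressedMap E V) := by
  obtain ⟨hmaps, ⟨A, hA, hA0⟩, hind⟩ := h
  have hlift : ∀ A : MatC r, V * _root_.compressedMap E V A * Vᴴ = E (V * A * Vᴴ) := by
    intro A
    rw [compressedMap_apply, conj_compress_isometry hVP]
    exact hP.mem_corner_iff.mp (hmaps (conj_isometry_mem_corner hV hVP A))
  have hcancel : ∀ Q : MatC r, V * Q * Vᴴ = P → Q = 1 := by
    intro Q hQ
    rw [← compress_conj_isometry hV Q, hQ, ← hVP]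
    calc _ = (Vᴴ * V) * (Vᴴ * V) := by simp only [Matrix.mul_assoc]
      _ = 1 := by rw [hV, Matrix.mul_one]
  have hne : ∀ Q : MatC r, Q ≠ 0 → V * Q * Vᴴ ≠ 0 := by
    intro Q hQ h0
    apply hQ
    rw [← compress_conj_isometry hV Q, h0, Matrix.mul_zero, Matrix.zero_mul]
  refine ⟨fun h0 => hA0 ?_, fun Q S hQ hS hQ0 hS0 hr hm => ?_⟩
  · have h1 := hlift (Vᴴ * A * V)
    rw [conj_compress_isometry hVP, hP.mem_corner_iff.mp hA, h0] at h1
    rw [← h1]; simp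
  · have hQ' := isStarProjection_conj_isometry hV hQ
    have hS' := isStarProjection_conj_isometry hV hS
    obtain ⟨h1, h2⟩ := hind _ _ hQ' hS' (conj_isometry_mem_corner hV hVP Q)
      (conj_isometry_mem_corner hV hVP S) (hne Q hQ0) (hne S hS0) (by
        rw [hQ'.rank_eq_iff hS', trace_conj_isometry hV, trace_conj_isometry hV]
        exact (hQ.rank_eq_iff hS).mp hr) (by
        rintro _ ⟨B, rfl⟩
        obtain ⟨C, hC⟩ := hm ⟨Vᴴ * B * V, rfl⟩
        dsimp only at hC ⊢
        have e : V * Q * Vᴴ * B * (V * Q * Vᴴ) = V * (Q * (Vᴴ * B * V) * Q) * Vᴴ := by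
          simp only [Matrix.mul_assoc]
        rw [hS'.mem_corner_iff, e, ← hlift, ← hC, conj_isometry_mul hV, conj_isometry_mul hV]
        congr 2
        exact hS.mem_corner_iff.mp ⟨C, rfl⟩)
    exact ⟨hcancel Q h1, hcancel S h2⟩

/-- A map that is fully indecomposable on a corner can be scaled inside this corner. -/
theorem IsFullyIndecomposableOn.exists_scaling (hE : IsPositiveMap E) (hP : IsStarProjection P)
    (h : IsFullyIndecomposableOn E P) :
    ∃ X ∈ corner P, ∃ Y ∈ corner P, Yᴴ * E (X * Xᴴ) * Y = P ∧
      ∀ A ∈ corner P, (Yᴴ * E (X * A * Xᴴ) * Y).trace = A.trace := by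
  obtain ⟨V, hV, hVP⟩ := hP.exists_isometry
  have hF := hE.compressedMap V
  obtain ⟨x, y, hs⟩ := (h.compressedMap hP hV hVP).isScalable hF
  have hlift : ∀ a : MatC P.rank, (V * y * Vᴴ)ᴴ * E ((V * x * Vᴴ) * (V * a * Vᴴ) * (V * x * Vᴴ)ᴴ) *
      (V * y * Vᴴ) = V * scaledMap (_root_.compressedMap E V) x y a * Vᴴ := by
    intro a
    have e : ∀ z : MatC P.rank, (V * z * Vᴴ)ᴴ = V * zᴴ * Vᴴ := by
      intro z
      simp only [Matrix.conjTranspose_mul, Matrix.conjTranspose_conjTranspose, Matrix.mul_assoc]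
    rw [e, e, conj_isometry_mul hV, conj_isometry_mul hV, scaledMap_apply, compressedMap_apply]
    simp only [Matrix.mul_assoc]
  refine ⟨V * x * Vᴴ, conj_isometry_mem_corner hV hVP x, V * y * Vᴴ,
    conj_isometry_mem_corner hV hVP y, ?_, fun A hA => ?_⟩
  · have h1 := hlift 1
    rw [hs.1, conj_isometry_mul hV, Matrix.mul_one, Matrix.mul_one, hVP] at h1
    exact h1
  · have h1 : A = V * (Vᴴ * A * V) * Vᴴ := by
      rw [conj_compress_isometry hVP, hP.mem_corner_iff.mp hA]
    conv_lhs => rw [h1]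
    conv_rhs => rw [h1]
    rw [hlift, trace_conj_isometry hV, trace_conj_isometry hV]
    exact IsDoublyStochasticMap.trace_map hs (hF.scaledMap x y) _

end Compression

/-! ### Scaling of direct sums -/

section DirectSum

variable {d : ℕ} {E : MatC d →ₗ[ℂ] MatC d}

/-- Off-diagonal blocks need no hypothesis: T = E*(P_k) is positive with tr(T P_j) = tr(P_k P_j) = 0
for j ≠ k, so it lives in the k-th corner, where trace preservation identifies it with P_k. -/
theorem IsPositiveMap.isDoublyStochasticMap_of_corners {ι : Type*} [Fintype ι]
    (hE : IsPositiveMap E) {P : ι → MatC d} (hP : ∀ i, IsStarProjection (P i))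
    (horth : ∀ i j, i ≠ j → P i * P j = 0) (hsum : ∑ i, P i = 1) (h1 : ∀ i, E (P i) = P i)
    (htr : ∀ i, ∀ A ∈ corner (P i), (E A).trace = A.trace) : IsDoublyStochasticMap E := by
  refine ⟨by rw [← hsum, map_sum]; exact Finset.sum_congr rfl fun i _ => h1 i, ?_⟩
  rw [← hsum, map_sum]
  refine Finset.sum_congr rfl fun k _ => ?_
  have hT := hE.hsAdjoint _ (hP k).posSemidef
  set T := _root_.hsAdjoint E (P k) with hTdef
  have hTP : T * P k = T := by
    conv_rhs => rw [← mul_one T, ← hsum, Finset.mul_sum]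
    symm
    rw [Finset.sum_eq_single k (fun j _ hj => ?_) (by simp)]
    refine hT.mul_eq_zero_of_trace (hP j).posSemidef ?_
    rw [hE.trace_hsAdjoint_mul (hP k).posSemidef.isHermitian, h1, horth k j hj.symm,
      Matrix.trace_zero]
  have hPT : P k * T = T := by
    have := congrArg Matrix.conjTranspose hTP
    rwa [Matrix.conjTranspose_mul, hT.isHermitian.eq, (hP k).conjTranspose_eq] at this
  refine Matrix.ext_iff_trace_mul_right.mpr fun A => ?_
  have hmem : P k * A * P k ∈ corner (P k) := ⟨A, rfl⟩
  calc (T * A).trace = (T * (P k * A * P k)).trace := by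
        conv_lhs => rw [← hPT, ← hTP]
        rw [← mul_assoc (P k), hPT, mul_assoc, ← mul_assoc T (P k * A), Matrix.trace_mul_comm,
          Matrix.trace_mul_comm (T * (P k * A)), ← mul_assoc (P k), hPT, Matrix.trace_mul_comm]
    _ = (P k * E (P k * A * P k)).trace :=
        hE.trace_hsAdjoint_mul (hP k).posSemidef.isHermitian _
    _ = (E (P k * A * P k)).trace := by
        have h2 := (hP k).mem_corner_iff.mp (hE.mapsTo_corner_of_map_eq (hP k) (hP k) (h1 k) hmem)
        rw [← h2, mul_assoc (P k), ← mul_assoc (P k) (P k), (hP k).mul_self]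
    _ = (P k * A * P k).trace := htr k _ hmem
    _ = (P k * A).trace := by
        rw [Matrix.trace_mul_comm, ← mul_assoc, (hP k).mul_self]

theorem sum_mul_of_mem_corner {ι : Type*} [Fintype ι] {P X : ι → MatC d}
    (hP : ∀ i, IsStarProjection (P i)) (horth : ∀ i j, i ≠ j → P i * P j = 0)
    (hX : ∀ i, X i ∈ corner (P i)) (i : ι) : (∑ j, X j) * P i = X i ∧ P i * (∑ j, X j) = X i := by
  have h : ∀ j, P j * X j * P j = X j := fun j => (hP j).mem_corner_iff.mp (hX j)
  constructor
  · rw [Finset.sum_mul, Finset.sum_eq_single i (fun j _ hj => ?_) (by simp)]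
    · rw [← h i, mul_assoc, (hP i).mul_self]
    · rw [← h j, mul_assoc, horth j i hj, mul_zero]
  · rw [Finset.mul_sum, Finset.sum_eq_single i (fun j _ hj => ?_) (by simp)]
    · rw [← h i, ← mul_assoc, ← mul_assoc, (hP i).mul_self]
    · rw [← h j, ← mul_assoc, ← mul_assoc, horth i j hj.symm, zero_mul, zero_mul]

theorem IsDirectSumOfFullyIndecomposables.isScalable (hE : IsPositiveMap E)
    (h : IsDirectSumOfFullyIndecomposables E) : IsScalable E := by
  obtain ⟨k, P, hP, horth, hsum, hFI⟩ := h
  choose X hX Y hY hunit htr using fun i => (hFI i).exists_scaling hE (hP i)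
  refine ⟨∑ i, X i, ∑ i, Y i, (hE.scaledMap _ _).isDoublyStochasticMap_of_corners hP horth hsum
    (fun i => ?_) fun i A hA => ?_⟩
  all_goals
    have hXi := (sum_mul_of_mem_corner hP horth hX i).1
    have hYi := (sum_mul_of_mem_corner hP horth hY i).2
    have hXi' : P i * (∑ j, X j)ᴴ = (X i)ᴴ := by
      have := congrArg Matrix.conjTranspose hXi
      rwa [Matrix.conjTranspose_mul, (hP i).conjTranspose_eq] at this
    have hYi' : (∑ j, Y j)ᴴ * P i = (Y i)ᴴ := by
      have := congrArg Matrix.conjTranspose hYi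
      rwa [Matrix.conjTranspose_mul, (hP i).conjTranspose_eq] at this
    -- Both sums collapse to their i-th terms: the inner one because A = P_i A P_i, the outer one
    -- because E preserves the corner.
    have key : ∀ A ∈ corner (P i), scaledMap E (∑ j, X j) (∑ j, Y j) A =
        (Y i)ᴴ * E (X i * A * (X i)ᴴ) * Y i := by
      intro A hA
      have hA' := (hP i).mem_corner_iff.mp hA
      have hXA : X i * A * (X i)ᴴ ∈ corner (P i) := by
        rw [(hP i).mem_corner_iff]
        have hPX : P i * X i = X i := by
          rw [← (hP i).mem_corner_iff.mp (hX i), ← mul_assoc, ← mul_assoc, (hP i).mul_self]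
        have hPX' : (X i)ᴴ * P i = (X i)ᴴ := by
          have := congrArg Matrix.conjTranspose hPX
          rwa [Matrix.conjTranspose_mul, (hP i).conjTranspose_eq] at this
        rw [← mul_assoc, ← mul_assoc, hPX, mul_assoc, hPX']
      have hEA := (hP i).mem_corner_iff.mp ((hFI i).1 hXA)
      rw [scaledMap_apply]
      have e1 : (∑ j, X j) * A * (∑ j, X j)ᴴ = X i * A * (X i)ᴴ := by
        rw [← hXi', ← hXi]
        conv_lhs => rw [← hA']
        simp only [mul_assoc]
      rw [e1, ← hEA, ← hYi', ← hYi]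
      conv_rhs => rw [← hEA]
      have hPP : ∀ M, P i * (P i * M) = P i * M := fun M => by rw [← mul_assoc, (hP i).mul_self]
      simp only [mul_assoc, hPP]
  · rw [key _ (self_mem_corner (hP i))]
    have hXP : X i * P i = X i := by
      rw [← (hP i).mem_corner_iff.mp (hX i), mul_assoc, (hP i).mul_self]
    rw [hXP, hunit i]
  · rw [key _ hA, htr i A hA]

end DirectSum

/-! ### Decomposition of doubly stochastic maps -/

section Decomposition

variable {d : ℕ} {E : MatC d →ₗ[ℂ] MatC d}

theorem IsStarProjection.rank_pos {P : MatC d} (hP : IsStarProjection P) (h0 : P ≠ 0) :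
    0 < P.rank := by
  refine Nat.pos_of_ne_zero fun h => h0 (hP.posSemidef.trace_eq_zero_iff.mp ?_)
  rw [hP.trace_eq_rank, h, Nat.cast_zero]

/-- The projection `R` is sent by `E` to a projection. -/
def IsProjectionPreserved (E : MatC d →ₗ[ℂ] MatC d) (R : MatC d) : Prop :=
  IsStarProjection R ∧ IsStarProjection (E R)

/-- `R` is minimal among the nonzero projections that `E` sends to projections. -/
def IsMinimalPreserved (E : MatC d →ₗ[ℂ] MatC d) (R : MatC d) : Prop :=
  IsProjectionPreserved E R ∧ R ≠ 0 ∧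
    ∀ P ∈ corner R, IsProjectionPreserved E P → P ≠ 0 → P = R

theorem mul_eq_of_mem_corner {P R : MatC d} (hR : IsStarProjection R) (h : P ∈ corner R) :
    R * P = P ∧ P * R = P := by
  rw [← hR.mem_corner_iff.mp h]
  constructor
  · rw [← mul_assoc, ← mul_assoc, hR.mul_self]
  · rw [mul_assoc, hR.mul_self]

/-- Positivity gives E(P) ≤ E(R), and the difference of nested projections is a projection. -/
theorem IsProjectionPreserved.sub (hE : IsPositiveMap E) {P R : MatC d}
    (hR : IsProjectionPreserved E R) (hP : IsProjectionPreserved E P) (h : P ∈ corner R) :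
    IsProjectionPreserved E (R - P) := by
  have h1 := hR.1.sub_of_mul_eq hP.1 (mul_eq_of_mem_corner hR.1 h).1
  refine ⟨h1, ?_⟩
  have h2 := hE _ h1.posSemidef
  rw [map_sub] at h2 ⊢
  exact hR.2.sub_of_mul_eq hP.2 (hR.2.mul_eq_right_of_le hP.2 h2)

theorem orthogonal_of_sum_eq {ι : Type*} [Fintype ι] {P : ι → MatC d} {R : MatC d}
    (hP : ∀ i, IsStarProjection (P i)) (horth : ∀ i j, i ≠ j → P i * P j = 0)
    (hsum : ∑ i, P i = R) (i : ι) : R * P i = P i ∧ P i * R = P i := by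
  rw [← hsum]
  exact sum_mul_of_mem_corner hP horth (fun i => self_mem_corner (hP i)) i

/-- Induction on the rank: a nonzero R that is not minimal splits into S and R - S, both preserved
and of smaller rank. -/
theorem IsProjectionPreserved.exists_minimal_decomposition (hE : IsPositiveMap E) {R : MatC d}
    (hR : IsProjectionPreserved E R) :
    ∃ (ι : Type) (_ : Fintype ι) (P : ι → MatC d), (∀ i, IsMinimalPreserved E (P i)) ∧
      (∀ i j, i ≠ j → P i * P j = 0) ∧ ∑ i, P i = R := by
  induction hn : R.rank using Nat.strong_induction_on generalizing R with
  | _ n ih =>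
    by_cases hR0 : R = 0
    · exact ⟨Empty, inferInstance, fun i => i.elim, fun i => i.elim, fun i => i.elim, by simp [hR0]⟩
    by_cases hmin : IsMinimalPreserved E R
    · refine ⟨Unit, inferInstance, fun _ => R, fun _ => hmin, fun i j h => absurd rfl h, by simp⟩
    · obtain ⟨S, hSR, hS, hS0, hne⟩ :
          ∃ S ∈ corner R, IsProjectionPreserved E S ∧ S ≠ 0 ∧ S ≠ R := by
        by_contra! hcon
        exact hmin ⟨hR, hR0, fun P hP hP1 hP2 => hcon P hP hP1 hP2⟩
      have hT := hR.sub hE hS hSR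
      have hT0 : R - S ≠ 0 := fun h => hne (sub_eq_zero.mp h).symm
      have hrank : R.rank = S.rank + (R - S).rank := by
        have h1 : (R.rank : ℂ) = S.rank + (R - S).rank := by
          rw [← hR.1.trace_eq_rank, ← hS.1.trace_eq_rank, ← hT.1.trace_eq_rank, Matrix.trace_sub]
          ring
        exact_mod_cast h1
      have hSpos := hS.1.rank_pos hS0
      have hTpos := hT.1.rank_pos hT0
      obtain ⟨ι, _, P, hP, hPo, hPs⟩ := ih S.rank (by omega) hS rfl
      obtain ⟨κ, _, Q, hQ, hQo, hQs⟩ := ih (R - S).rank (by omega) hT rfl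
      have hPS := orthogonal_of_sum_eq (fun i => (hP i).1.1) hPo hPs
      have hQT := orthogonal_of_sum_eq (fun i => (hQ i).1.1) hQo hQs
      have hSR' := mul_eq_of_mem_corner hR.1 hSR
      refine ⟨ι ⊕ κ, inferInstance, Sum.elim P Q, ?_, ?_, ?_⟩
      · rintro (i | i)
        · exact hP i
        · exact hQ i
      · rintro (i | i) (j | j) hij
        · exact hPo i j fun h => hij (by rw [h])
        · change P i * Q j = 0
          rw [← (hPS i).2, ← (hQT j).1, mul_assoc, ← mul_assoc S, mul_sub, hSR'.2, hS.1.mul_self,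
            sub_self, zero_mul, mul_zero]
        · change Q i * P j = 0
          rw [← (hPS j).1, ← (hQT i).2, mul_assoc, ← mul_assoc (R - S), sub_mul, hSR'.1,
            hS.1.mul_self, sub_self, zero_mul, mul_zero]
        · exact hQo i j fun h => hij (by rw [h])
      · rw [Fintype.sum_sum_type]
        simp only [Sum.elim_inl, Sum.elim_inr]
        rw [hPs, hQs, add_sub_cancel]

/-- Two projections of equal rank are related by a partial isometry. -/
theorem IsStarProjection.exists_partial_isometry {P Q : MatC d} (hP : IsStarProjection P)
    (hQ : IsStarProjection Q) (h : P.rank = Q.rank) :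
    ∃ W : MatC d, W * Wᴴ = P ∧ W * Q = W := by
  obtain ⟨V, hV, hVP⟩ := hP.exists_isometry
  obtain ⟨V', hV', hVQ⟩ : ∃ V' : Matrix (Fin d) (Fin P.rank) ℂ, V'ᴴ * V' = 1 ∧ V' * V'ᴴ = Q :=
    h ▸ hQ.exists_isometry
  refine ⟨V * V'ᴴ, ?_, ?_⟩
  · calc V * V'ᴴ * (V * V'ᴴ)ᴴ = V * (V'ᴴ * V') * Vᴴ := by
          simp only [Matrix.conjTranspose_mul, Matrix.conjTranspose_conjTranspose, Matrix.mul_assoc]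
      _ = P := by rw [hV', Matrix.mul_one, hVP]
  · calc V * V'ᴴ * Q = V * (V'ᴴ * V') * V'ᴴ := by rw [← hVQ]; simp only [Matrix.mul_assoc]
      _ = _ := by rw [hV', Matrix.mul_one]

/-- The minimal preserved projections may be moved by `E`, but their images are orthogonal with
unchanged ranks, so one unitary carries every image back. Minimality then becomes full
indecomposability on each corner. -/
theorem IsDoublyStochasticMap.exists_unitary_directSum (hds : IsDoublyStochasticMap E)
    (hE : IsPositiveMap E) :
    ∃ U ∈ Matrix.unitaryGroup (Fin d) ℂ, IsDirectSumOfFullyIndecomposables (scaledMap E 1 Uᴴ) := by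
  have h1 : IsProjectionPreserved E 1 := ⟨.one _, by rw [hds.1]; exact .one _⟩
  obtain ⟨ι, _, P, hP, horth, hsum⟩ := h1.exists_minimal_decomposition hE
  have hPs : ∀ i, IsStarProjection (P i) := fun i => (hP i).1.1
  have hrank : ∀ {R : MatC d}, IsProjectionPreserved E R → R.rank = (E R).rank := fun hR => by
    rw [hR.1.rank_eq_iff hR.2, hds.trace_map hE]
  have hQo : ∀ i j, i ≠ j → E (P i) * E (P j) = 0 := by
    intro i j hij
    -- Orthogonality is the order relation P_j ≤ 1 - P_i, which a positive unital map preserves.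
    have h2 : (1 - P i) * P j = P j := by rw [sub_mul, one_mul, horth i j hij, sub_zero]
    have h3 := hE _ (((hPs i).one_sub.sub_of_mul_eq (hPs j) h2).posSemidef)
    rw [map_sub, map_sub, hds.1] at h3
    have h4 := (hP i).1.2.one_sub.mul_eq_right_of_le (hP j).1.2 h3
    rwa [sub_mul, one_mul, sub_eq_self] at h4
  choose W hW hWQ using fun i =>
    (hPs i).exists_partial_isometry (hP i).1.2 (hrank (hP i).1)
  have hUmem : ∑ i, W i ∈ Matrix.unitaryGroup (Fin d) ℂ := by
    rw [Matrix.mem_unitaryGroup_iff, ← hsum]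
    change (∑ i, W i) * (∑ i, W i)ᴴ = _
    rw [Matrix.conjTranspose_sum, Finset.sum_mul]
    refine Finset.sum_congr rfl fun i _ => ?_
    rw [Finset.mul_sum, Finset.sum_eq_single i (fun j _ hj => ?_) (by simp), hW]
    have e : E (P j) * (W j)ᴴ = (W j)ᴴ := by
      have := congrArg Matrix.conjTranspose (hWQ j)
      rwa [Matrix.conjTranspose_mul, (hP j).1.2.conjTranspose_eq] at this
    rw [← hWQ i, ← e, mul_assoc, ← mul_assoc (E (P i)), hQo i j hj.symm, zero_mul, mul_zero]
  set U := ∑ i, W i with hUdef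
  have hUQ : ∀ i, U * E (P i) = W i := by
    intro i
    rw [hUdef, Finset.sum_mul, Finset.sum_eq_single i (fun j _ hj => ?_) (by simp), hWQ]
    rw [← hWQ j, mul_assoc, hQo j i hj, mul_zero]
  have hU1 := Matrix.mem_unitaryGroup_left hUmem
  have hU2 := Matrix.mem_unitaryGroup_right hUmem
  set G := scaledMap E 1 Uᴴ with hGdef
  have hGa : ∀ A, G A = U * E A * Uᴴ := fun A => by
    rw [hGdef, scaledMap_apply, Matrix.conjTranspose_conjTranspose, Matrix.conjTranspose_one,
      one_mul, mul_one]
  have hG : IsPositiveMap G := hE.scaledMap _ _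
  have hGds : IsDoublyStochasticMap G := by
    change IsScaling E 1 Uᴴ
    rw [isScaling_iff, Matrix.conjTranspose_conjTranspose, Matrix.conjTranspose_one, one_mul,
      one_mul, mul_one, hU1, hds.1, hds.2, mul_one, hU2]
    exact ⟨rfl, rfl⟩
  have hGP : ∀ i, G (P i) = P i := fun i => by
    have e : (W i)ᴴ = E (P i) * Uᴴ := by
      rw [← hUQ i, Matrix.conjTranspose_mul, (hP i).1.2.conjTranspose_eq]
    calc G (P i) = U * (E (P i) * E (P i)) * Uᴴ := by rw [hGa, (hP i).1.2.mul_self]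
      _ = (U * E (P i)) * (E (P i) * Uᴴ) := by simp only [mul_assoc]
      _ = P i := by rw [← e, hUQ, hW]
  -- Conjugation by U does not affect being a projection, so minimality with respect to `E` can be
  -- used for `G`.
  have hback : ∀ {R : MatC d}, IsStarProjection R → IsStarProjection (G R) →
      IsProjectionPreserved E R := by
    intro R hR hGR
    have e : E R = Uᴴ * G R * U := by
      rw [hGa]
      calc E R = (Uᴴ * U) * E R * (Uᴴ * U) := by rw [hU1, one_mul, mul_one]
        _ = _ := by simp only [mul_assoc]
    refine ⟨hR, ?_, ?_⟩
    · change E R * E R = E R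
      calc E R * E R = Uᴴ * (G R * (U * Uᴴ) * G R) * U := by rw [e]; simp only [mul_assoc]
        _ = E R := by rw [hU2, mul_one, hGR.mul_self, e]
    · exact (hE R hR.posSemidef).isHermitian
  refine ⟨U, hUmem, Fintype.card ι, fun k => P ((Fintype.equivFin ι).symm k), fun k => hPs _,
    fun k l hkl => horth _ _ fun h => hkl ((Fintype.equivFin ι).symm.injective h), ?_, fun k => ?_⟩
  · rw [Equiv.sum_comp (Fintype.equivFin ι).symm P, hsum]
  · dsimp only
    generalize (Fintype.equivFin ι).symm k = i
    refine ⟨hG.mapsTo_corner_of_map_eq (hPs i) (hPs i) (hGP i),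
      ⟨P i, self_mem_corner (hPs i), by rw [hGP]; exact (hP i).2.1⟩,
      fun R S hR hS hRP hSP hR0 hS0 hr hm => ?_⟩
    -- A corner inclusion of equal ranks forces G(R) = S, so R is preserved and minimality applies.
    have hGR := hGds.map_eq_of_mapsTo hG hR hS hr hm
    have hRi := (hP i).2.2 R hRP (hback hR (by rwa [hGR])) hR0
    exact ⟨hRi, by rw [← hGR, hRi, hGP]⟩

end Decomposition

/-! ### Assembly of the two equivalences -/

theorem mainTheorem1 (d : ℕ) (hd : 1 ≤ d) (E : MatC d →ₗ[ℂ] MatC d) (hE : IsPositiveMap E) :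
    (IsScalable E ↔ ∃ X Y : MatC d, IsDirectSumOfFullyIndecomposables (scaledMap E X Yᴴ)) ∧
      (IsUniquelyScalable E ↔ IsFullyIndecomposable E) := by
  have : NeZero d := ⟨by omega⟩
  refine ⟨⟨?_, ?_⟩, fun h => h.isFullyIndecomposable hE, fun h => h.isUniquelyScalable hE⟩
  · rintro ⟨X, Y, hs⟩
    obtain ⟨U, -, hU⟩ := hs.exists_unitary_directSum (hE.scaledMap X Y)
    -- The aligning unitary is absorbed into the left factor, which in the statement is the adjoint
    -- of the second argument of `scaledMap`.
    refine ⟨X, U * Yᴴ, ?_⟩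
    rwa [scaledMap_scaledMap, mul_one, ← Matrix.conjTranspose_conjTranspose Y,
      ← Matrix.conjTranspose_mul] at hU
  · rintro ⟨X, Y, hds⟩
    obtain ⟨Z, W, hs⟩ := hds.isScalable (hE.scaledMap X Yᴴ)
    refine ⟨X * Z, Yᴴ * W, ?_⟩
    rwa [IsScaling, scaledMap_scaledMap] at hs
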